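/- Let $q\ge 1$ be an integer and let $\Gamma$ be a finite connected $(q+1)$-regular simple graph with $|\Gamma|$ vertices and adjacency operator $T$. For $t\in\mathbb{C}$ put $Z_T(t)=\operatorname{tr} e^{tT}$, and let $I_n(z)=\sum_{m\ge 0}\frac{(z/2)^{2m+n}}{m!\,(m+n)!}$ be the modified Bessel function of the first kind. A closed path of length $l\geq 1$ is a sequence of vertices $(v_1,\dots,v_l)$ with $v_j$ adjacent to $v_{j+1}$ for all $j$, indices taken modulo $l$; the closed paths of length $0$ are the vertices. We write $|p|$ for the length of $p$. A trajectory is a class of closed paths up to cyclic permutation, that is, a closed path whose starting point is forgotten. Two closed paths are homotopic if their trajectories are connected by finitely many insertions or deletions of a backtrack, $(v_1,\dots,v_j,\dots,v_n)\leftrightarrow(v_1,\dots,v_j,v',v_j,\dots,v_n)$ with $v'$ adjacent to $v_j$; a closed path is contractible if it is homotopic to a path of length $0$. A geodesic is a trajectory with $v_i\ne v_{i+2}$ for all $i$, indices taken cyclically; it is long if its length $|\gamma|$ is positive. A geodesic path is a geodesic with a chosen starting point, that is, a closed path whose trajectory is a geodesic. A trajectory is primitive if it is not an $r$-th power (the trajectory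 walked around $r$ times) of a trajectory for any $r\ge 2$. For a long geodesic $\gamma=(\gamma')^r$ with $r\geq 1$ and $\gamma'$ primitive, let $\Lambda(\gamma)=|\gamma'|$. Let $G$ be the set of long geodesics, and let $\mathbf{gp}_l$ be the number of geodesic paths of length $l$. **Theorem (trace formula for regular graphs).** For every $t\in\mathbb{C}$, the integral $$[Z_T(t)]_{con}=|\Gamma|\cdot\frac{q+1}{2\pi}\int_{-2\sqrt q}^{2\sqrt q}e^{st}\,\frac{\sqrt{4q-s^2}}{(q+1)^2-s^2}\,ds$$ converges absolutely and equals the contribution $\sum_{p\ \mathrm{contractible}} \frac{t^{|p|}}{|p|!}$ of the contractible closed paths $p$ of $\Gamma$. Moreover $$Z_T(t)=[Z_T(t)]_{con}+\sum_{\gamma\in G}\Lambda(\gamma)\,q^{-|\gamma|/2}\,I_{|\gamma|}(2\sqrt q\,t)$$ and $$Z_T(t)=[Z_T(t)]_{con}+\sum_{l=3}^{\infty}\mathbf{gp}_l\;q^{-l/2}\,I_l(2\sqrt q\,t),$$ where all the sums converge absolutely. -/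

import Mathlib

namespace TraceFormula

open SimpleGraph

variable {V : Type*}

/-- A closed path on `G`: a closed walk with its starting point. The closed paths of length `0`
are the vertices of `G`. -/
abbrev ClosedPath (G : SimpleGraph V) : Type _ := Σ v : V, G.Walk v v

/-- The number of steps of a closed path. -/
def ClosedPath.length {G : SimpleGraph V} (p : ClosedPath G) : ℕ := p.2.length

/-- Cyclic permutation: the closed path `u → v → u`, composed of two arbitrary walks, becomes
the closed path `v → u → v`. -/
inductive CyclicPerm (G : SimpleGraph V) : ClosedPath G → ClosedPath G → Prop
  | mk {u v : V} (p : G.Walk u v) (r : G.Walk v u) :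
      CyclicPerm G ⟨u, p.append r⟩ ⟨v, r.append p⟩

/-- A closed trajectory: a closed path whose starting point is forgotten. -/
def Trajectory (G : SimpleGraph V) : Type _ := Quot (CyclicPerm G)

/-- The trajectory of a closed path. -/
def ClosedPath.trajectory {G : SimpleGraph V} (p : ClosedPath G) : Trajectory G :=
  Quot.mk _ p

/-- The length of a trajectory. -/
def Trajectory.length {G : SimpleGraph V} : Trajectory G → ℕ :=
  Quot.lift ClosedPath.length (by
    rintro _ _ ⟨p, r⟩
    simp [ClosedPath.length, add_comm])

/-- The trajectory `(v_1, …, v_n)` is a geodesic: `v_i ≠ v_{i+2}` for all `i` taken cyclically.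
Here `d = (v_i, v_{i+1})` and `e = (v_{i+1}, v_{i+2})` run over all pairs of cyclically
consecutive steps. Trajectories of length `0` satisfy this. -/
def Trajectory.IsGeodesic {G : SimpleGraph V} : Trajectory G → Prop :=
  Quot.lift
    (fun p => Cycle.Chain (fun d e : G.Dart => d.fst ≠ e.snd) (p.2.darts : Cycle G.Dart)) (by
    rintro _ _ ⟨p, r⟩
    have h : ((p.append r).darts : Cycle G.Dart) = ((r.append p).darts : Cycle G.Dart) := by
      rw [Cycle.coe_eq_coe, Walk.darts_append, Walk.darts_append]
      exact List.isRotated_append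
    simp only [h])

/-- A closed walk run through `r` times. -/
def iterate {G : SimpleGraph V} {v : V} (p : G.Walk v v) : ℕ → G.Walk v v
  | 0 => Walk.nil
  | r + 1 => p.append (iterate p r)

theorem iterate_append_comm {G : SimpleGraph V} {u v : V} (p : G.Walk u v) (s : G.Walk v u)
    (r : ℕ) : (iterate (p.append s) r).append p = p.append (iterate (s.append p) r) := by
  induction r with
  | zero => simp [iterate]
  | succ r ih =>
    rw [iterate, ← Walk.append_assoc, ih, iterate]
    simp only [Walk.append_assoc]

/-- `γ.powSucc n` is the power `γ ^ (n + 1)`: the trajectory `γ` walked around `n + 1` times. -/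
def Trajectory.powSucc {G : SimpleGraph V} (γ : Trajectory G) (n : ℕ) : Trajectory G :=
  Quot.lift (fun p : ClosedPath G => ClosedPath.trajectory ⟨p.1, iterate p.2 (n + 1)⟩) (by
    rintro _ _ ⟨p, s⟩
    have h : iterate (s.append p) (n + 1) = (s.append (iterate (p.append s) n)).append p := by
      rw [← Walk.append_assoc, iterate_append_comm]
      simp only [iterate, Walk.append_assoc]
    have h' : iterate (p.append s) (n + 1) = p.append (s.append (iterate (p.append s) n)) := by
      simp only [iterate, Walk.append_assoc]
    simp only [h, h']
    exact Quot.sound (CyclicPerm.mk _ _)) γ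

/-- A trajectory is primitive if it is not the `r`-th power, `r ≥ 2`, of any trajectory. -/
def Trajectory.IsPrimitive {G : SimpleGraph V} (γ : Trajectory G) : Prop :=
  ∀ (δ : Trajectory G) (n : ℕ), 1 ≤ n → γ ≠ δ.powSucc n

/-- `Λ(γ)`: the length of the primitive trajectory `δ` with `γ = δ ^ r`, `r ≥ 1`
(the length of `δ` depends on `γ` only if `γ` has positive length). -/
noncomputable def Trajectory.primitiveLength {G : SimpleGraph V} (γ : Trajectory G) : ℕ :=
  sInf {k : ℕ | ∃ (δ : Trajectory G) (n : ℕ),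
    δ.IsPrimitive ∧ γ = δ.powSucc n ∧ k = δ.length}

/-- The set of long geodesics, i.e. of geodesic trajectories of positive length. -/
def longGeodesics (G : SimpleGraph V) : Set (Trajectory G) :=
  {γ | γ.IsGeodesic ∧ 0 < γ.length}

/-- The number of geodesic paths of length `l`. -/
noncomputable def geodesicPathCount (G : SimpleGraph V) (l : ℕ) : ℕ :=
  Set.ncard {p : ClosedPath G | p.trajectory.IsGeodesic ∧ p.length = l}

/-- An elementary homotopy of trajectories: at a vertex `v` of the trajectory, a step to a
neighbour `w` of `v` and back is inserted. -/
inductive ElementaryHomotopy (G : SimpleGraph V) : Trajectory G → Trajectory G → Prop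
  | insert {u v w : V} (p : G.Walk u v) (r : G.Walk v u) (h : G.Adj v w) :
      ElementaryHomotopy G (ClosedPath.trajectory ⟨u, p.append r⟩)
        (ClosedPath.trajectory ⟨u, p.append (Walk.cons h (Walk.cons h.symm r))⟩)

/-- Two closed paths are homotopic if their trajectories are connected by a chain of elementary
homotopies, forward or backward. -/
def Homotopic {G : SimpleGraph V} (p p' : ClosedPath G) : Prop :=
  Relation.EqvGen (ElementaryHomotopy G) p.trajectory p'.trajectory

/-- The set of contractible closed paths: those homotopic to a path of length `0`. -/
def contractiblePaths (G : SimpleGraph V) : Set (ClosedPath G) :=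
  {p | ∃ p₀ : ClosedPath G, p₀.length = 0 ∧ Homotopic p p₀}

/-- `Z_T(t) = tr exp(t T)` with `T` the adjacency (averaging) operator. -/
noncomputable def stateSum [Fintype V] [DecidableEq V] (G : SimpleGraph V) [DecidableRel G.Adj]
    (t : ℂ) : ℂ :=
  Matrix.trace (NormedSpace.exp (t • G.adjMatrix ℂ))

/-- The modified Bessel function of the first kind
`I_n(z) = ∑_m (z / 2) ^ (2 m + n) / (m! (m + n)!)`. -/
noncomputable def besselI (n : ℕ) (z : ℂ) : ℂ :=
  ∑' m : ℕ, (z / 2) ^ (2 * m + n) / ((m.factorial : ℂ) * ((m + n).factorial : ℂ))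

/-- The integrand `e ^ (s t) √(4 q - s²) / ((q + 1)² - s²)`. -/
noncomputable def contractibleIntegrand (q : ℕ) (t : ℂ) (s : ℝ) : ℂ :=
  Complex.exp (s * t) * ((√(4 * q - s ^ 2) / ((q + 1) ^ 2 - s ^ 2) : ℝ) : ℂ)

/-- `q ^ (-n / 2) I_n(2 √q t)`. -/
noncomputable def geodesicWeight (q : ℕ) (t : ℂ) (n : ℕ) : ℂ :=
  (((q : ℝ) ^ (-(n : ℝ) / 2) : ℝ) : ℂ) * besselI n (2 * ((√(q : ℝ) : ℝ) : ℂ) * t)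

end TraceFormula

/-! The trace of `T ^ n` counts the closed paths of length `n`, so it is enough to split this number
for each `n` and to sum against `t ^ n / n!`. The splitting (`trace_adjMatrix_pow`) is `tr T ^ n =
|Γ| a(n) + ∑ c(n, k) gp_k`, where `a(n)` counts closed walks at a vertex of the `(q + 1)`-regular
tree and `c(n, k)` is the coefficient of `z ^ k` in `(z + q / z) ^ n`.

To obtain it, write `T = z + q / z` formally and expand `T ^ n` in the Chebyshev polynomials `z ^ k
+ (q / z) ^ k`. The trace of the `k`-th one is `gp_k = tr H ^ k`, with `H` the Hashimoto
non-backtracking matrix on darts, up to a defect `(q - 1) |Γ|` for even `k > 0`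
(`trace_hashimoto_pow`). The defects and the constant term add up to `|Γ| a(n)`
(`treeWalkCount_zero_eq`).

Since `c(2m + l, l) = (2m + l choose m) q ^ m`, the exponential generating function of `c(·, l)` is
`q ^ (-l / 2) I_l(2 √q t)` (`geodesicWeight_eq_tsum`). Passing from geodesic paths to geodesics
brings in `Λ(γ)`, because a long geodesic has as many starting points as its sequence of steps has
distinct rotations (`ClosedPath.ncard_fiber`).

Two descriptions of `a(n)` give the contractible term. Cancelling backtracks turns each walk into a
reduced one, the number of walks with a given reduced form obeys the tree recursion, and a homotopy
invariant in a free group shows that contractible paths are exactly those reducing to a point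
(`ncard_contractiblePaths`). Analytically, `a(n)` is the `n`-th moment of the Kesten–McKay density
(`treeMoment_eq`): both sequences satisfy one inhomogeneous recursion, and a growth comparison
excludes the homogeneous solution. -/

namespace TraceFormula

/-! ### Walk counts on the regular tree and Chebyshev coefficients -/

/-- The number of walks of length `n` between two fixed vertices at distance `k` of the
`(q + 1)`-regular tree. -/
def treeWalkCount (q : ℕ) : ℕ → ℕ → ℕ
  | 0, 0 => 1
  | 0, _ + 1 => 0
  | n + 1, 0 => (q + 1) * treeWalkCount q n 1
  | n + 1, k + 1 => treeWalkCount q n k + q * treeWalkCount q n (k + 2)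

/-- The coefficient of the `k`-th Chebyshev-type polynomial in the `n`-th power. -/
def chebCoeff (q : ℕ) : ℕ → ℕ → ℕ
  | 0, 0 => 1
  | 0, _ + 1 => 0
  | n + 1, 0 => 2 * q * chebCoeff q n 1
  | n + 1, k + 1 => chebCoeff q n k + q * chebCoeff q n (k + 2)

theorem chebCoeff_eq_zero_of_lt {q n k : ℕ} (h : n < k) : chebCoeff q n k = 0 := by
  induction n generalizing k with
  | zero => obtain ⟨k, rfl⟩ := Nat.exists_eq_succ_of_ne_zero h.ne'; rfl
  | succ n ih =>
    obtain ⟨k, rfl⟩ := Nat.exists_eq_succ_of_ne_zero (Nat.ne_zero_of_lt h)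
    simp [chebCoeff, ih (show n < k by omega), ih (show n < k + 2 by omega)]

theorem chebCoeff_eq_zero_of_odd {q n k : ℕ} (h : Odd (n + k)) : chebCoeff q n k = 0 := by
  induction n generalizing k with
  | zero =>
    cases k with
    | zero => simp at h
    | succ k => rfl
  | succ n ih =>
    cases k with
    | zero => simp [chebCoeff, ih (k := 1) (by simpa using h)]
    | succ k =>
      have h1 : Odd (n + k) := by grind
      have h2 : Odd (n + (k + 2)) := by grind
      simp [chebCoeff, ih h1, ih h2]

/-- Pascal's rule for the coefficient of `z ^ l` in `(z + q / z) ^ (2m + l)`. The factor `2 q` in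
the recursion at `0` reflects that the two middle binomial coefficients of an odd row agree. -/
theorem chebCoeff_two_mul_add (q m l : ℕ) :
    chebCoeff q (2 * m + l) l = (2 * m + l).choose m * q ^ m := by
  suffices H : ∀ n m l, n = 2 * m + l → chebCoeff q n l = n.choose m * q ^ m from H _ m l rfl
  intro n
  induction n with
  | zero =>
    intro m l h
    obtain ⟨rfl, rfl⟩ : m = 0 ∧ l = 0 := by omega
    simp [chebCoeff]
  | succ n ih =>
    intro m l h
    cases l with
    | zero =>
      obtain ⟨m, rfl⟩ : ∃ m', m = m' + 1 := ⟨m - 1, by omega⟩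
      have hn : n = 2 * m + 1 := by omega
      rw [chebCoeff, ih m 1 hn, Nat.choose_succ_succ]
      have : n.choose (m + 1) = n.choose m := by
        rw [hn]; exact Nat.choose_symm_half m
      rw [this]; ring
    | succ l =>
      cases m with
      | zero =>
        rw [chebCoeff, ih 0 l (by omega), chebCoeff_eq_zero_of_lt (by omega)]
        simp
      | succ m =>
        rw [chebCoeff, ih (m + 1) l (by omega), ih m (l + 2) (by omega), Nat.choose_succ_succ]
        ring

theorem treeWalkCount_eq_zero_of_odd {q n k : ℕ} (h : Odd (n + k)) : treeWalkCount q n k = 0 := by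
  induction n generalizing k with
  | zero =>
    cases k with
    | zero => simp at h
    | succ k => rfl
  | succ n ih =>
    cases k with
    | zero => simp [treeWalkCount, ih (k := 1) (by simpa using h)]
    | succ k =>
      have h1 : Odd (n + k) := by grind
      have h2 : Odd (n + (k + 2)) := by grind
      simp [treeWalkCount, ih h1, ih h2]

/-- The two recursions differ only at `0`, where `q + 1 ≤ 2 q`. This supplies the growth bound `(4
q) ^ k` for tree walks. -/
theorem treeWalkCount_le_chebCoeff {q : ℕ} (hq : 1 ≤ q) (n k : ℕ) :
    treeWalkCount q n k ≤ chebCoeff q n k := by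
  induction n generalizing k with
  | zero => cases k <;> rfl
  | succ n ih =>
    cases k with
    | zero =>
      rw [treeWalkCount, chebCoeff]
      exact Nat.mul_le_mul (by omega) (ih 1)
    | succ k =>
      rw [treeWalkCount, chebCoeff]
      exact Nat.add_le_add (ih k) (Nat.mul_le_mul_left _ (ih _))

/-- The differences `a_k - a_{k+2}` and `c_k - q c_{k+2}` satisfy the same recursion: at `k = 0` the
distinct boundary factors `q + 1` and `2 q` both leave `q` times the difference at `1`. -/
theorem treeWalkCount_add_eq_chebCoeff_add (q n k : ℕ) :
    treeWalkCount q n k + q * chebCoeff q n (k + 2) =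
      treeWalkCount q n (k + 2) + chebCoeff q n k := by
  induction n generalizing k with
  | zero => cases k <;> simp [treeWalkCount, chebCoeff]
  | succ n ih =>
    cases k with
    | zero =>
      have h := ih 1
      simp only [treeWalkCount, chebCoeff] at *
      linear_combination q * h
    | succ k =>
      have h := ih k
      have h' := ih (k + 2)
      simp only [treeWalkCount, chebCoeff] at *
      linear_combination h + q * h'

theorem treeWalkCount_eq_zero_of_lt {q n k : ℕ} (h : n < k) : treeWalkCount q n k = 0 := by
  induction n generalizing k with
  | zero => obtain ⟨k, rfl⟩ := Nat.exists_eq_succ_of_ne_zero h.ne'; rfl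
  | succ n ih =>
    obtain ⟨k, rfl⟩ := Nat.exists_eq_succ_of_ne_zero (Nat.ne_zero_of_lt h)
    simp [treeWalkCount, ih (show n < k by omega), ih (show n < k + 2 by omega)]

/-- `treeWalkCount q n 0` in terms of the `chebCoeff q n k`. -/
theorem treeWalkCount_zero_eq (q n : ℕ) :
    (treeWalkCount q n 0 : ℤ) = chebCoeff q n 0 -
      (q - 1) * ∑ k ∈ Finset.range n, if Even (k + 1) then (chebCoeff q n (k + 1) : ℤ) else 0 := by
  -- `g x N` is `x` at the least even index `≥ N`, the end term when the preceding identity is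
  -- telescoped over even `k < N`. Both end terms vanish for `N = n + 1`.
  let g (x : ℕ → ℤ) (N : ℕ) : ℤ := if Even N then x N else x (N + 1)
  have key (N : ℕ) : (treeWalkCount q n 0 : ℤ) - g (fun k => treeWalkCount q n k) N +
      q * g (fun k => chebCoeff q n k) N = q * chebCoeff q n 0 -
      (q - 1) * ∑ k ∈ Finset.range N, if Even k then (chebCoeff q n k : ℤ) else 0 := by
    induction N with
    | zero => simp [g]
    | succ N ih =>
      have h := treeWalkCount_add_eq_chebCoeff_add q n N
      zify at h
      rw [Finset.sum_range_succ]
      by_cases hN : Even N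
      · simp only [g, hN, Nat.even_add_one, not_true, if_true, if_false] at ih ⊢
        linear_combination ih + h
      · simp only [g, hN, Nat.even_add_one, not_false_eq_true, if_true, if_false] at ih ⊢
        linear_combination ih
  have h := key (n + 1)
  simp only [g, treeWalkCount_eq_zero_of_lt (show n < n + 1 by omega),
    treeWalkCount_eq_zero_of_lt (show n < n + 1 + 1 by omega),
    chebCoeff_eq_zero_of_lt (show n < n + 1 by omega),
    chebCoeff_eq_zero_of_lt (show n < n + 1 + 1 by omega), Nat.cast_zero, ite_self,
    Finset.sum_range_succ' _ n, Even.zero, if_true] at h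
  linear_combination h

end TraceFormula

/-! ### Chebyshev polynomials of the adjacency matrix and the Hashimoto matrix -/

namespace TraceFormula

open SimpleGraph Matrix

/-- The Chebyshev-type polynomials `z ^ k + (c / z) ^ k` of the matrix `A = z + c / z`
(with the constant term halved for `k = 0`). -/
def chebMatrix {n : Type*} [Fintype n] [DecidableEq n] (c : ℂ) (A : Matrix n n ℂ) :
    ℕ → Matrix n n ℂ
  | 0 => 1
  | 1 => A
  | 2 => A * A - (2 * c) • 1
  | k + 3 => A * chebMatrix c A (k + 2) - c • chebMatrix c A (k + 1)

theorem mul_chebMatrix {n : Type*} [Fintype n] [DecidableEq n] (c : ℂ) (A : Matrix n n ℂ) (k : ℕ) :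
    A * chebMatrix c A (k + 1) =
      chebMatrix c A (k + 2) + (if k = 0 then 2 * c else c) • chebMatrix c A k := by
  cases k <;> simp [chebMatrix]

/-- The recursion of `chebCoeff` is the transpose of multiplication by `A` on the `chebMatrix`
family; the constant `2 c` in degree 2 matches the factor `2 q` at index `0`. -/
theorem pow_eq_sum_chebMatrix {n : Type*} [Fintype n] [DecidableEq n] (q : ℕ)
    (A : Matrix n n ℂ) (N : ℕ) :
    A ^ N = ∑ k ∈ Finset.range (N + 1), (chebCoeff q N k : ℂ) • chebMatrix q A k := by
  induction N with
  | zero => simp [chebCoeff, chebMatrix]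
  | succ N ih =>
    have e1 : A ^ (N + 1) =
        ∑ k ∈ Finset.range (N + 2), (chebCoeff q N k : ℂ) • (A * chebMatrix q A k) := by
      rw [pow_succ', ih, Finset.sum_range_succ _ (N + 1),
        chebCoeff_eq_zero_of_lt (show N < N + 1 by omega), Finset.mul_sum]
      simp
    -- `e2` reindexes the terms lowered in degree by `A`, `e3` those raised.
    have e2 : ∑ k ∈ Finset.range (N + 1),
          (chebCoeff q N (k + 1) : ℂ) • ((if k = 0 then 2 * (q : ℂ) else q) • chebMatrix q A k) =
        (2 * q * chebCoeff q N 1 : ℂ) • chebMatrix q A 0 +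
        ∑ k ∈ Finset.range (N + 1), (q * chebCoeff q N (k + 2) : ℂ) • chebMatrix q A (k + 1) := by
      rw [Finset.sum_range_succ', Finset.sum_range_succ _ N,
        chebCoeff_eq_zero_of_lt (show N < N + 2 by omega)]
      simp only [Nat.cast_zero, mul_zero, zero_smul, add_zero, if_true, smul_smul,
        Nat.add_eq_zero_iff, one_ne_zero, and_false, if_false]
      rw [add_comm, mul_comm (chebCoeff q N (0 + 1) : ℂ)]
      exact congrArg _ (Finset.sum_congr rfl fun k _ => by rw [mul_comm])
    have e3 : (chebCoeff q N 0 : ℂ) • chebMatrix q A 1 +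
        ∑ k ∈ Finset.range (N + 1), (chebCoeff q N (k + 1) : ℂ) • chebMatrix q A (k + 2) =
        ∑ k ∈ Finset.range (N + 1), (chebCoeff q N k : ℂ) • chebMatrix q A (k + 1) := by
      rw [Finset.sum_range_succ, Finset.sum_range_succ' _ N,
        chebCoeff_eq_zero_of_lt (show N < N + 1 by omega)]
      simp only [Nat.cast_zero, zero_smul, add_zero]
      rw [add_comm]
    rw [e1, Finset.sum_range_succ', Finset.sum_range_succ' _ (N + 1)]
    simp only [mul_chebMatrix, smul_add, Finset.sum_add_distrib, chebCoeff, e2]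
    push_cast
    simp only [add_smul, Finset.sum_add_distrib, ← e3]
    simp only [chebMatrix, Matrix.mul_one]
    abel

section Hashimoto

variable {V : Type*} [DecidableEq V] (G : SimpleGraph V)

/-- The relation between consecutive steps of a geodesic. -/
def NonBacktracking {V : Type*} (G : SimpleGraph V) (d e : G.Dart) : Prop :=
  G.DartAdj d e ∧ d.fst ≠ e.snd

instance {V : Type*} [DecidableEq V] (G : SimpleGraph V) : DecidableRel (NonBacktracking G) :=
  fun d e => inferInstanceAs (Decidable (d.snd = e.fst ∧ d.fst ≠ e.snd))

/-- The Hashimoto matrix. -/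
def hashimoto : Matrix G.Dart G.Dart ℂ :=
  .of fun d e => if NonBacktracking G d e then 1 else 0

/-- The incidence between darts and their end points. -/
def dartEnd : Matrix G.Dart V ℂ := .of fun d v => if d.snd = v then 1 else 0

/-- The incidence between vertices and the darts starting there. -/
def dartStart : Matrix V G.Dart ℂ := .of fun v d => if d.fst = v then 1 else 0

/-- The reversal of darts. -/
def dartReversal : Matrix G.Dart G.Dart ℂ := .of fun d e => if d.symm = e then 1 else 0

theorem dartReversal_transpose : (dartReversal G)ᵀ = dartReversal G := by
  ext d e
  simp only [dartReversal, of_apply, transpose_apply]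
  grind [Dart.symm_symm]

variable [Fintype V]

/-- Among the darts that can follow `d`, only its reversal backtracks. -/
theorem hashimoto_eq : hashimoto G = dartEnd G * dartStart G - dartReversal G := by
  ext d e
  have : d.symm = e ↔ d.snd = e.fst ∧ d.fst = e.snd := by
    rw [Dart.ext_iff, Prod.ext_iff]; simp [Dart.symm]
  simp only [hashimoto, dartEnd, dartStart, dartReversal, Matrix.sub_apply, Matrix.mul_apply,
    of_apply, ite_mul, one_mul, zero_mul, Finset.sum_ite_eq, Finset.mem_univ, if_true,
    NonBacktracking, DartAdj, this]
  by_cases h1 : d.snd = e.fst <;> by_cases h2 : d.fst = e.snd <;>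
    simp [h1, h2, eq_comm (a := e.fst)]

variable [DecidableRel G.Adj]

theorem dartStart_mul_dartEnd : dartStart G * dartEnd G = G.adjMatrix ℂ := by
  ext u v
  simp only [dartEnd, dartStart, mul_apply, of_apply, adjMatrix_apply, ite_mul, one_mul, zero_mul]
  split_ifs with h
  · rw [Finset.sum_eq_single (⟨(u, v), h⟩ : G.Dart)]
    · simp
    · intro d _ hd
      by_contra hne
      apply hd
      rw [Dart.ext_iff, Prod.ext_iff]
      grind
    · simp
  · apply Finset.sum_eq_zero
    intro d _
    have := d.adj
    grind

theorem dartReversal_mul_self : dartReversal G * dartReversal G = 1 := by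
  ext d e
  simp only [dartReversal, mul_apply, of_apply, ite_mul, one_mul, zero_mul, Finset.sum_ite_eq,
    Finset.mem_univ, if_true, Dart.symm_symm, Matrix.one_apply]

theorem dartStart_mul_dartReversal : dartStart G * dartReversal G = (dartEnd G)ᵀ := by
  ext v d
  simp only [dartStart, dartReversal, dartEnd, mul_apply, of_apply, transpose_apply, mul_ite,
    mul_one, mul_zero]
  rw [Finset.sum_eq_single d.symm] <;> simp
  grind [Dart.symm_symm]

theorem transpose_dartEnd_mul_dartReversal : (dartEnd G)ᵀ * dartReversal G = dartStart G := by
  rw [← dartStart_mul_dartReversal, Matrix.mul_assoc, dartReversal_mul_self, Matrix.mul_one]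

theorem dartReversal_mul_dartEnd : dartReversal G * dartEnd G = (dartStart G)ᵀ := by
  rw [← transpose_dartEnd_mul_dartReversal, transpose_mul, dartReversal_transpose,
    transpose_transpose]

theorem trace_hashimoto : (hashimoto G).trace = 0 := by
  apply Finset.sum_eq_zero
  intro d _
  simp [hashimoto, NonBacktracking, DartAdj, d.adj.ne']

variable {G}

theorem dartStart_mul_transpose {d : ℕ} (hreg : G.IsRegularOfDegree d) :
    dartStart G * (dartStart G)ᵀ = (d : ℂ) • (1 : Matrix V V ℂ) := by
  ext u v
  simp only [dartStart, mul_apply, of_apply, transpose_apply, Matrix.smul_apply,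
    Matrix.one_apply, ite_mul, one_mul, zero_mul]
  split_ifs with h
  · subst h
    rw [← hreg u, ← G.dart_fst_fiber_card_eq_degree u]
    simp only [Finset.card_filter]
    push_cast
    simp only [smul_eq_mul, mul_one]
    exact Finset.sum_congr rfl fun d _ => by split_ifs <;> rfl
  · rw [Finset.sum_eq_zero]
    · simp
    · grind

theorem transpose_dartEnd_mul {d : ℕ} (hreg : G.IsRegularOfDegree d) :
    (dartEnd G)ᵀ * dartEnd G = (d : ℂ) • (1 : Matrix V V ℂ) := by
  rw [← dartStart_mul_dartReversal, Matrix.mul_assoc, dartReversal_mul_dartEnd,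
    dartStart_mul_transpose hreg]

theorem dartStart_mul_hashimoto :
    dartStart G * hashimoto G = G.adjMatrix ℂ * dartStart G - (dartEnd G)ᵀ := by
  rw [hashimoto_eq, Matrix.mul_sub, ← Matrix.mul_assoc, dartStart_mul_dartEnd,
    dartStart_mul_dartReversal]

theorem transpose_dartEnd_mul_hashimoto {q : ℕ} (hreg : G.IsRegularOfDegree (q + 1)) :
    (dartEnd G)ᵀ * hashimoto G = (q : ℂ) • dartStart G := by
  rw [hashimoto_eq, Matrix.mul_sub, ← Matrix.mul_assoc, transpose_dartEnd_mul hreg,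
    transpose_dartEnd_mul_dartReversal]
  push_cast
  rw [add_smul, one_smul, Matrix.add_mul]
  simp

variable (G) in
/-- The matrix counting the walks of length `l + 1` without backtracking. -/
def reducedWalkMatrix (l : ℕ) : Matrix V V ℂ := dartStart G * hashimoto G ^ l * dartEnd G

theorem reducedWalkMatrix_zero : reducedWalkMatrix G 0 = G.adjMatrix ℂ := by
  simp [reducedWalkMatrix, dartStart_mul_dartEnd]

theorem reducedWalkMatrix_one {q : ℕ} (hreg : G.IsRegularOfDegree (q + 1)) :
    reducedWalkMatrix G 1 = G.adjMatrix ℂ * G.adjMatrix ℂ - ((q : ℂ) + 1) • 1 := by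
  rw [reducedWalkMatrix, pow_one, dartStart_mul_hashimoto, Matrix.sub_mul, Matrix.mul_assoc,
    dartStart_mul_dartEnd, transpose_dartEnd_mul hreg]
  push_cast
  rfl

theorem reducedWalkMatrix_add_two {q : ℕ} (hreg : G.IsRegularOfDegree (q + 1)) (l : ℕ) :
    reducedWalkMatrix G (l + 2) =
      G.adjMatrix ℂ * reducedWalkMatrix G (l + 1) - (q : ℂ) • reducedWalkMatrix G l := by
  rw [reducedWalkMatrix, pow_succ' _ (l + 1), ← Matrix.mul_assoc (dartStart G),
    dartStart_mul_hashimoto, Matrix.sub_mul, pow_succ' _ l, ← Matrix.mul_assoc (dartEnd G)ᵀ,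
    transpose_dartEnd_mul_hashimoto hreg, Matrix.sub_mul, reducedWalkMatrix, reducedWalkMatrix,
    pow_succ' _ l]
  simp only [Matrix.mul_assoc, Matrix.smul_mul]

/-- Both sides obey the recursion `X_{l+2} = A X_{l+1} - q X_l`, as second-kind and first-kind
Chebyshev polynomials do. Two initial values are checked by hand because the low degrees carry the
exceptional constants `q + 1` and `2 q`. -/
theorem reducedWalkMatrix_sub {q : ℕ} (hreg : G.IsRegularOfDegree (q + 1)) (l : ℕ) :
    reducedWalkMatrix G (l + 2) - (q : ℂ) • reducedWalkMatrix G l =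
      chebMatrix q (G.adjMatrix ℂ) (l + 3) - chebMatrix q (G.adjMatrix ℂ) (l + 1) := by
  induction l using Nat.twoStepInduction with
  | zero =>
    rw [reducedWalkMatrix_add_two hreg, reducedWalkMatrix_one hreg, reducedWalkMatrix_zero]
    simp only [chebMatrix, Matrix.mul_sub, Matrix.mul_smul, Matrix.mul_one]
    module
  | one =>
    rw [reducedWalkMatrix_add_two hreg, reducedWalkMatrix_add_two hreg,
      reducedWalkMatrix_one hreg, reducedWalkMatrix_zero]
    simp only [chebMatrix, Matrix.mul_sub, Matrix.mul_smul, Matrix.mul_one]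
    module
  | more l h1 h2 =>
    rw [reducedWalkMatrix_add_two hreg (l + 2)]
    rw [show chebMatrix q (G.adjMatrix ℂ) (l + 2 + 3) = G.adjMatrix ℂ *
      chebMatrix q (G.adjMatrix ℂ) (l + 4) -
        (q : ℂ) • chebMatrix q (G.adjMatrix ℂ) (l + 3) from rfl]
    have h3 := reducedWalkMatrix_add_two hreg l
    rw [eq_add_of_sub_eq h1, eq_comm, sub_eq_iff_eq_add] at h3
    rw [eq_add_of_sub_eq h2, eq_add_of_sub_eq h1]
    simp only [Matrix.mul_sub, Matrix.mul_add, Matrix.mul_smul, h3]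
    rw [show l + 1 + 3 = l + 4 from rfl, show l + 1 + 1 = l + 2 from rfl,
      show l + 2 + 1 = l + 3 from rfl, show chebMatrix q (G.adjMatrix ℂ) (l + 3) =
        G.adjMatrix ℂ * chebMatrix q (G.adjMatrix ℂ) (l + 2) -
          (q : ℂ) • chebMatrix q (G.adjMatrix ℂ) (l + 1) from rfl]
    module

/-- A closed reduced walk is a geodesic path unless its last step reverses its first. Substituting
`hashimoto_eq` for one factor isolates these walks with a tail, and `e1` together with
`transpose_dartEnd_mul_hashimoto` strips the tail off. -/
theorem trace_hashimoto_pow_add_three {q : ℕ} (hreg : G.IsRegularOfDegree (q + 1)) (l : ℕ) :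
    (hashimoto G ^ (l + 3)).trace = (reducedWalkMatrix G (l + 2)).trace -
      q * (reducedWalkMatrix G l).trace + (hashimoto G ^ (l + 1)).trace := by
  have e1 : hashimoto G * dartReversal G = dartEnd G * (dartEnd G)ᵀ - 1 := by
    rw [hashimoto_eq, Matrix.sub_mul, Matrix.mul_assoc, dartStart_mul_dartReversal,
      dartReversal_mul_self]
  have e2 : (hashimoto G ^ (l + 2) * dartReversal G).trace =
      q * (reducedWalkMatrix G l).trace - (hashimoto G ^ (l + 1)).trace := by
    rw [pow_succ, Matrix.mul_assoc, e1, Matrix.mul_sub, Matrix.mul_one, trace_sub,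
      ← Matrix.mul_assoc, trace_mul_comm, ← Matrix.mul_assoc, pow_succ' _ l, ← Matrix.mul_assoc,
      transpose_dartEnd_mul_hashimoto hreg, Matrix.smul_mul, Matrix.smul_mul, trace_smul,
      smul_eq_mul, reducedWalkMatrix]
  rw [pow_succ _ (l + 2)]
  conv_lhs => enter [1, 2]; rw [hashimoto_eq]
  rw [Matrix.mul_sub, trace_sub, e2, ← Matrix.mul_assoc, trace_mul_comm, ← Matrix.mul_assoc,
    ← reducedWalkMatrix]
  ring

variable (G) in
theorem trace_hashimoto_sq :
    (hashimoto G ^ 2).trace = 0 := by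
  apply Finset.sum_eq_zero
  intro d _
  rw [sq]
  simp only [diag_apply, hashimoto, mul_apply, of_apply]
  apply Finset.sum_eq_zero
  intro e _
  simp only [NonBacktracking, DartAdj]
  grind

/-- By the two preceding identities the defect is 2-periodic in the exponent, so exponents 1 and 2
determine it: a simple graph has no geodesic path of length 1 or 2. -/
theorem trace_hashimoto_pow {q : ℕ} (hreg : G.IsRegularOfDegree (q + 1)) (k : ℕ) :
    (hashimoto G ^ (k + 1)).trace = (chebMatrix q (G.adjMatrix ℂ) (k + 1)).trace +
      if Even (k + 1) then (q - 1 : ℂ) * Fintype.card V else 0 := by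
  induction k using Nat.twoStepInduction with
  | zero => simp [trace_hashimoto, chebMatrix]
  | one =>
    have h : (G.adjMatrix ℂ * G.adjMatrix ℂ).trace = (q + 1 : ℂ) * Fintype.card V := by
      simp only [trace, diag_apply, adjMatrix_mul_self_apply_self, hreg.degree_eq,
        Finset.sum_const, Finset.card_univ, nsmul_eq_mul]
      push_cast
      ring
    rw [trace_hashimoto_sq G]
    simp [chebMatrix, h]
    ring
  | more k h1 h2 =>
    have h := congrArg trace (reducedWalkMatrix_sub hreg k)
    rw [trace_sub, trace_sub, trace_smul, smul_eq_mul] at h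
    rw [trace_hashimoto_pow_add_three hreg, h, h1]
    have : Even (k + 2 + 1) ↔ Even (k + 1) := by grind
    simp only [this]
    ring

/-- The trace of a power of the adjacency matrix. -/
theorem trace_adjMatrix_pow {q : ℕ} (hreg : G.IsRegularOfDegree (q + 1)) (n : ℕ) :
    (G.adjMatrix ℂ ^ n).trace = Fintype.card V * treeWalkCount q n 0 +
      ∑ k ∈ Finset.range n, (chebCoeff q n (k + 1) : ℂ) * (hashimoto G ^ (k + 1)).trace := by
  have h : (treeWalkCount q n 0 : ℂ) = chebCoeff q n 0 - (q - 1) * ∑ k ∈ Finset.range n,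
      if Even (k + 1) then (chebCoeff q n (k + 1) : ℂ) else 0 := by
    exact_mod_cast congrArg (Int.cast : ℤ → ℂ) (treeWalkCount_zero_eq q n)
  rw [pow_eq_sum_chebMatrix q, trace_sum, Finset.sum_range_succ', h]
  simp only [trace_smul, smul_eq_mul, trace_hashimoto_pow hreg, mul_add, Finset.sum_add_distrib]
  simp only [chebMatrix, trace_one]
  rw [mul_sub, mul_comm (Fintype.card V : ℂ) ((q - 1 : ℂ) * _), mul_assoc, Finset.sum_mul,
    Finset.mul_sum]
  -- In this form the defects cancel against the sum subtracted in `treeWalkCount_zero_eq`.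
  have : ∀ k, (chebCoeff q n (k + 1) : ℂ) *
      (if Even (k + 1) then (q - 1 : ℂ) * Fintype.card V else 0) =
      (q - 1) * ((if Even (k + 1) then (chebCoeff q n (k + 1) : ℂ) else 0) * Fintype.card V) := by
    intro k; split_ifs <;> ring
  simp only [this]
  ring

end Hashimoto

end TraceFormula

/-! ### Geodesic paths as cyclic chains of darts -/

namespace TraceFormula

open SimpleGraph Matrix

section ChainCount

variable {α : Type*} [Fintype α] [DecidableEq α] (r : α → α → Prop) [DecidableRel r]

/-- The lists of length `n` which can be inserted between `a` and `b` to form a chain. -/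
def chainsBetween : ℕ → α → α → Finset (List α)
  | 0, a, b => if r a b then {[]} else ∅
  | n + 1, a, b => (Finset.univ.filter (r a)).biUnion fun c =>
      (chainsBetween n c b).map ⟨List.cons c, List.cons_injective⟩

theorem mem_chainsBetween {n : ℕ} {a b : α} {l : List α} :
    l ∈ chainsBetween r n a b ↔ l.length = n ∧ List.IsChain r (a :: (l ++ [b])) := by
  induction n generalizing a l with
  | zero =>
    rw [chainsBetween]
    split_ifs with h
    · cases l <;> simp [h]
    · cases l <;> simp [h]
  | succ n ih =>
    cases l with
    | nil => simp [chainsBetween]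
    | cons c l =>
      simp only [chainsBetween, Finset.mem_biUnion, Finset.mem_filter, Finset.mem_univ, true_and,
        Finset.mem_map, Function.Embedding.coeFn_mk, List.cons.injEq, ih, List.length_cons,
        List.cons_append, List.isChain_cons_cons]
      grind

theorem card_chainsBetween (n : ℕ) (a b : α) :
    ((chainsBetween r n a b).card : ℂ) =
      ((.of fun a b => if r a b then (1 : ℂ) else 0 : Matrix α α ℂ) ^ (n + 1)) a b := by
  induction n generalizing a with
  | zero => rw [chainsBetween]; split_ifs with h <;> simp [h]
  | succ n ih =>
    rw [chainsBetween, Finset.card_biUnion, pow_succ', Matrix.mul_apply]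
    · push_cast
      simp only [Finset.card_map, ih, of_apply, ite_mul, one_mul, zero_mul, Finset.sum_filter]
    · intro c _ d _ hcd
      rw [Function.onFun, Finset.disjoint_left]
      simp only [Finset.mem_map, Function.Embedding.coeFn_mk]
      grind

/-- A nonempty cyclic chain is its head `a` together with a list fitting between `a` and `a`, which
a diagonal entry of the matrix power counts. -/
theorem ncard_cyclic_chains (n : ℕ) :
    (Set.ncard {l : List α | l.length = n + 1 ∧ Cycle.Chain r (l : Cycle α)} : ℂ) =
      ((.of fun a b => if r a b then (1 : ℂ) else 0 : Matrix α α ℂ) ^ (n + 1)).trace := by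
  have h : {l : List α | l.length = n + 1 ∧ Cycle.Chain r (l : Cycle α)} =
      ((Finset.univ.biUnion fun a =>
        (chainsBetween r n a a).map ⟨List.cons a, List.cons_injective⟩ : Finset (List α)) :
        Set (List α)) := by
    ext l
    cases l with
    | nil => simp
    | cons a l => simp [mem_chainsBetween]
  rw [h, Set.ncard_coe_finset, Finset.card_biUnion, trace]
  · push_cast
    simp only [Finset.card_map, card_chainsBetween, diag_apply]
  · intro c _ d _ hcd
    rw [Function.onFun, Finset.disjoint_left]
    simp only [Finset.mem_map, Function.Embedding.coeFn_mk]
    grind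

end ChainCount

variable {V : Type*} {G : SimpleGraph V}

/-- The list of steps of a closed path. -/
def ClosedPath.darts (p : ClosedPath G) : List G.Dart := p.2.darts

theorem ClosedPath.length_darts (p : ClosedPath G) : p.darts.length = p.length :=
  Walk.length_darts _

theorem ClosedPath.eq_of_darts_eq {p p' : ClosedPath G} (h : p.darts = p'.darts)
    (hp : 0 < p.length) : p = p' := by
  obtain ⟨u, p⟩ := p
  obtain ⟨u', p'⟩ := p'
  have hu : u = u' := by
    cases p with
    | nil => simp [ClosedPath.length] at hp
    | cons h₁ p =>
      cases p' with
      | nil => simp [ClosedPath.darts] at h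
      | cons h₂ p' =>
        simp only [ClosedPath.darts, Walk.darts_cons, List.cons.injEq, Dart.ext_iff,
          Prod.ext_iff] at h
        exact h.1.1
  subst hu
  exact congrArg (Sigma.mk u) (Walk.darts_injective h)

theorem cycle_chain_and {α : Type*} {r s : α → α → Prop} {c : Cycle α} :
    c.Chain (fun a b => r a b ∧ s a b) ↔ c.Chain r ∧ c.Chain s := by
  induction c using Cycle.induction_on with
  | nil => simp
  | cons a l _ =>
    simp only [Cycle.chain_coe_cons, List.isChain_iff_getElem]
    grind

theorem ClosedPath.chain_dartAdj (p : ClosedPath G) :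
    Cycle.Chain G.DartAdj (p.darts : Cycle G.Dart) := by
  obtain ⟨u, p⟩ := p
  cases p with
  | nil => simp [ClosedPath.darts]
  | cons h p =>
    -- Repeating the first step at the end turns the cyclic condition into a linear one.
    have := Walk.isChain_dartAdj_darts ((Walk.cons h p).concat h)
    simpa [Walk.darts_concat, ClosedPath.darts] using this

theorem ClosedPath.exists_darts_eq {l : List G.Dart} (hl : l ≠ [])
    (h : Cycle.Chain G.DartAdj (l : Cycle G.Dart)) : ∃ p : ClosedPath G, p.darts = l := by
  obtain ⟨a, m, rfl⟩ := List.exists_cons_of_ne_nil hl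
  rw [Cycle.chain_coe_cons, ← List.cons_append, List.isChain_append] at h
  have hclosed : ((a :: m).getLast hl).snd = a.fst :=
    h.2.2 _ (by rw [List.getLast?_eq_getLast_of_ne_nil hl]; simp) a (by simp)
  exact ⟨⟨_, (Walk.ofDarts (a :: m) hl h.1).copy rfl hclosed⟩,
    (Walk.darts_copy _ rfl hclosed).trans (Walk.darts_ofDarts hl h.1)⟩

theorem ClosedPath.isGeodesic_iff (p : ClosedPath G) :
    p.trajectory.IsGeodesic ↔ Cycle.Chain (NonBacktracking G) (p.darts : Cycle G.Dart) := by
  change Cycle.Chain (fun d e : G.Dart => d.fst ≠ e.snd) (p.darts : Cycle G.Dart) ↔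
    Cycle.Chain (fun d e : G.Dart => G.DartAdj d e ∧ d.fst ≠ e.snd) (p.darts : Cycle G.Dart)
  rw [cycle_chain_and, and_iff_right p.chain_dartAdj]

/-- A closed path of positive length is determined by its darts. In length 0 the empty list forgets
the vertex, hence `n + 1`. -/
theorem geodesicPathCount_succ [Fintype V] [DecidableEq V] [DecidableRel G.Adj] (n : ℕ) :
    (geodesicPathCount G (n + 1) : ℂ) = (hashimoto G ^ (n + 1)).trace := by
  rw [hashimoto, ← ncard_cyclic_chains, geodesicPathCount]
  congr 1
  refine Set.ncard_congr (fun p _ => p.darts) ?_ ?_ ?_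
  · rintro p ⟨h1, h2⟩
    exact ⟨by rw [p.length_darts, h2], p.isGeodesic_iff.1 h1⟩
  · rintro p p' ⟨-, h⟩ - hd
    exact ClosedPath.eq_of_darts_eq hd (by omega)
  · rintro l ⟨h1, h2⟩
    obtain ⟨p, rfl⟩ := ClosedPath.exists_darts_eq (l := l) (by rintro rfl; simp at h1)
      (h2.imp fun _ _ h => h.1)
    exact ⟨p, ⟨p.isGeodesic_iff.2 h2, by rw [← p.length_darts, h1]⟩, rfl⟩

theorem geodesicPathCount_one [Fintype V] [DecidableEq V] [DecidableRel G.Adj] :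
    geodesicPathCount G 1 = 0 := by
  have := geodesicPathCount_succ (G := G) 0
  rw [zero_add, pow_one, trace_hashimoto] at this
  exact_mod_cast this

theorem geodesicPathCount_two [Fintype V] [DecidableEq V] [DecidableRel G.Adj] :
    geodesicPathCount G 2 = 0 := by
  have := geodesicPathCount_succ (G := G) 1
  rw [trace_hashimoto_sq] at this
  exact_mod_cast this

end TraceFormula

/-! ### Trajectories, powers and rotation periods -/

namespace TraceFormula

open SimpleGraph

section ListPeriod

variable {α : Type*}

theorem append_flatten_replicate_comm {s t : List α} (h : s ++ t = t ++ s) (n : ℕ) :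
    s ++ (List.replicate n t).flatten = (List.replicate n t).flatten ++ s := by
  induction n with
  | zero => simp
  | succ n ih =>
    rw [List.replicate_succ, List.flatten_cons, ← List.append_assoc, h, List.append_assoc, ih,
      List.append_assoc]

theorem exists_eq_append_of_append_comm {s t : List α} (h : s ++ t = t ++ s)
    (hl : s.length ≤ t.length) : ∃ u, t = s ++ u ∧ s ++ u = u ++ s := by
  obtain ⟨u, rfl⟩ : s <+: t :=
    List.prefix_of_prefix_length_le (List.prefix_append s t) (h ▸ List.prefix_append t s) hl
  refine ⟨u, rfl, ?_⟩
  rw [List.append_assoc] at h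
  exact List.append_cancel_left h

theorem rotate_length_eq_self_of_append_comm {s t : List α} (h : s ++ t = t ++ s)
    (hl : s.length ≤ t.length) : t.rotate s.length = t := by
  obtain ⟨u, rfl, hu⟩ := exists_eq_append_of_append_comm h hl
  rw [List.rotate_append_length_eq, hu]

/-- A word commuting with `s` and at least as long starts with `s`, and the remainder still commutes
with `s`; copies of `s` are peeled off. -/
theorem eq_flatten_replicate_of_append_comm {s t : List α} (h : s ++ t = t ++ s) {m : ℕ}
    (hl : t.length = m * s.length) : t = (List.replicate m s).flatten := by
  induction m generalizing t with
  | zero => simpa using hl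
  | succ m ih =>
    obtain ⟨u, rfl, hu⟩ := exists_eq_append_of_append_comm h (by rw [hl]; nlinarith)
    rw [List.replicate_succ, List.flatten_cons, ← ih hu]
    rw [List.length_append] at hl
    linarith

theorem iterate_rotate_one (l : List α) (n : ℕ) :
    (fun l : List α => l.rotate 1)^[n] l = l.rotate n := by
  induction n with
  | zero => simp
  | succ n ih => rw [Function.iterate_succ_apply', ih, List.rotate_rotate]

/-- The minimal period of a list under rotation. -/
noncomputable def rotationPeriod (l : List α) : ℕ :=
  Function.minimalPeriod (fun l : List α => l.rotate 1) l

theorem rotationPeriod_dvd_iff {l : List α} {n : ℕ} : rotationPeriod l ∣ n ↔ l.rotate n = l := by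
  rw [rotationPeriod, ← Function.isPeriodicPt_iff_minimalPeriod_dvd, Function.IsPeriodicPt,
    Function.IsFixedPt, iterate_rotate_one]

theorem rotationPeriod_dvd_length (l : List α) : rotationPeriod l ∣ l.length :=
  rotationPeriod_dvd_iff.2 (List.rotate_length l)

theorem rotationPeriod_pos {l : List α} (hl : l ≠ []) : 0 < rotationPeriod l :=
  Nat.pos_of_dvd_of_pos (rotationPeriod_dvd_length l) (List.length_pos_iff.2 hl)

theorem setOf_isRotated_eq_image {l : List α} (hl : l ≠ []) :
    {l' | l ~r l'} = (fun n => l.rotate n) '' Set.Iio (rotationPeriod l) := by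
  ext l'
  constructor
  · rintro ⟨n, rfl⟩
    refine ⟨n % rotationPeriod l, Nat.mod_lt _ (rotationPeriod_pos hl), ?_⟩
    have := Function.iterate_mod_minimalPeriod_eq (f := fun l : List α => l.rotate 1) (x := l)
      (n := n)
    simpa only [iterate_rotate_one, rotationPeriod] using this
  · rintro ⟨n, -, rfl⟩
    exact ⟨n, rfl⟩

theorem ncard_isRotated {l : List α} (hl : l ≠ []) :
    Set.ncard {l' | l ~r l'} = rotationPeriod l := by
  rw [setOf_isRotated_eq_image hl, Set.InjOn.ncard_image, Set.ncard_eq_toFinset_card']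
  · simp
  · have := Function.iterate_injOn_Iio_minimalPeriod (f := fun l : List α => l.rotate 1) (x := l)
    simpa only [iterate_rotate_one, rotationPeriod] using this

theorem finite_isRotated (l : List α) : {l' | l ~r l'}.Finite := by
  refine Set.Finite.subset (List.finite_toSet l.cyclicPermutations) fun l' h => ?_
  exact List.mem_cyclicPermutations_iff.2 (List.IsRotated.symm h)

end ListPeriod

variable {V : Type*} {G : SimpleGraph V}

/-- The cyclic list of steps of a trajectory. -/
def Trajectory.darts : Trajectory G → Cycle G.Dart :=
  Quot.lift (fun p => (p.darts : Cycle G.Dart)) (by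
    rintro _ _ ⟨p, r⟩
    rw [Cycle.coe_eq_coe]
    simp only [ClosedPath.darts, Walk.darts_append]
    exact List.isRotated_append)

/-- Rotating by `n` means cutting the walk after `n` steps and exchanging the two pieces. -/
theorem ClosedPath.cyclicPerm_of_rotate_eq {p p' : ClosedPath G} (hp : 0 < p.length) {n : ℕ}
    (hn : n ≤ p.length) (h : p.darts.rotate n = p'.darts) : CyclicPerm G p p' := by
  obtain ⟨u, p⟩ := p
  have hperm := CyclicPerm.mk (p.take n) (p.drop n)
  rw [Walk.append_take_drop_eq] at hperm
  have heq : p' = ⟨_, (p.drop n).append (p.take n)⟩ := by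
    symm
    apply ClosedPath.eq_of_darts_eq
    rotate_left
    · simp only [ClosedPath.length, Walk.length_append, Walk.take_length, Walk.drop_length] at *
      omega
    rw [← h, List.rotate_eq_drop_append_take (by rwa [ClosedPath.length_darts])]
    simp [ClosedPath.darts, Walk.darts_append, Walk.darts_take, Walk.darts_drop]
  rwa [heq]

theorem ClosedPath.trajectory_eq_iff {p p' : ClosedPath G} (hp : 0 < p.length) :
    p.trajectory = p'.trajectory ↔ p.darts ~r p'.darts := by
  constructor
  · intro h
    exact Cycle.coe_eq_coe.1 (congrArg Trajectory.darts h)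
  · intro h
    obtain ⟨n, hn, h⟩ := List.isRotated_iff_mod.1 h
    exact Quot.sound (ClosedPath.cyclicPerm_of_rotate_eq hp (by rwa [← p.length_darts]) h)

theorem darts_iterate {v : V} (p : G.Walk v v) (n : ℕ) :
    (iterate p n).darts = (List.replicate n p.darts).flatten := by
  induction n with
  | zero => rfl
  | succ n ih => rw [iterate, Walk.darts_append, ih, List.replicate_succ, List.flatten_cons]

theorem ClosedPath.powSucc_trajectory (p : ClosedPath G) (n : ℕ) :
    p.trajectory.powSucc n = ClosedPath.trajectory ⟨p.1, iterate p.2 (n + 1)⟩ := rfl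

theorem rotate_eq_self_of_powSucc {p p₀ : ClosedPath G} {n : ℕ} (hp : 0 < p.length)
    (h : p.trajectory = p₀.trajectory.powSucc n) :
    p.darts.rotate p₀.length = p.darts ∧ p.length = (n + 1) * p₀.length := by
  rw [p₀.powSucc_trajectory, ClosedPath.trajectory_eq_iff hp] at h
  have hd : ClosedPath.darts ⟨p₀.1, iterate p₀.2 (n + 1)⟩ =
    (List.replicate (n + 1) p₀.darts).flatten := darts_iterate _ _
  rw [hd] at h
  have hlen : p.length = (n + 1) * p₀.length := by
    rw [← p.length_darts, h.perm.length_eq, ← p₀.length_darts]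
    simp
  refine ⟨?_, hlen⟩
  obtain ⟨k, hk⟩ := h.symm
  have h1 : ((List.replicate (n + 1) p₀.darts).flatten).rotate p₀.darts.length =
      (List.replicate (n + 1) p₀.darts).flatten :=
    rotate_length_eq_self_of_append_comm (append_flatten_replicate_comm rfl _) (by
      simp only [List.length_flatten, List.map_replicate, List.sum_replicate, smul_eq_mul]
      nlinarith)
  rw [← hk, List.rotate_rotate, add_comm k, ← List.rotate_rotate, ← p₀.length_darts, h1]

/-- Converse of `rotate_eq_self_of_powSucc`: invariance under rotation by `e` makes the first `e`
steps commute with the whole step list, which is then a power of them. -/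
theorem ClosedPath.exists_root {p : ClosedPath G} (hp : 0 < p.length) {e : ℕ} (he : 0 < e)
    (hdvd : e ∣ p.length) (hrot : p.darts.rotate e = p.darts) :
    ∃ (p₀ : ClosedPath G) (m : ℕ), p₀.length = e ∧ p.trajectory = p₀.trajectory.powSucc m := by
  have hle := Nat.le_of_dvd hp hdvd
  obtain ⟨u, p⟩ := p
  -- The path restarted after `e` steps has the same darts as `p`, hence the same base vertex.
  have hclosed : p.getVert e = u := by
    have h : (⟨_, (p.drop e).append (p.take e)⟩ : ClosedPath G) = ⟨u, p⟩ := by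
      apply ClosedPath.eq_of_darts_eq
      · rw [← hrot, List.rotate_eq_drop_append_take (by rwa [ClosedPath.length_darts])]
        simp [ClosedPath.darts, Walk.darts_append, Walk.darts_take, Walk.darts_drop]
      · simp only [ClosedPath.length, Walk.length_append, Walk.take_length, Walk.drop_length] at *
        omega
    exact congrArg Sigma.fst h
  obtain ⟨m, hm⟩ := hdvd
  obtain ⟨m, rfl⟩ : ∃ k, m = k + 1 := ⟨m - 1, by
    have : m ≠ 0 := by rintro rfl; simp at hm; omega
    omega⟩
  simp only [ClosedPath.length] at hm hle
  refine ⟨⟨u, (p.take e).copy rfl hclosed⟩, m, ?_, ?_⟩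
  · simp [ClosedPath.length, hle]
  · rw [ClosedPath.powSucc_trajectory]
    congr 1
    apply ClosedPath.eq_of_darts_eq _ hp
    simp only [ClosedPath.darts, darts_iterate, Walk.darts_copy, Walk.darts_take] at hrot ⊢
    have hlen : p.darts.length = e * (m + 1) := by rw [Walk.length_darts, hm]
    rw [List.rotate_eq_drop_append_take (by rwa [Walk.length_darts])] at hrot
    apply eq_flatten_replicate_of_append_comm
    · rw [← congrArg (p.darts.take e ++ ·) hrot]
      simp only [← List.append_assoc, List.take_append_drop]
    · rw [hlen, List.length_take, hlen, min_eq_left (by nlinarith), mul_comm]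

/-- `Λ(γ)` is the rotation period of the sequence of steps. -/
theorem ClosedPath.primitiveLength_trajectory {p : ClosedPath G} (hp : 0 < p.length) :
    p.trajectory.primitiveLength = rotationPeriod p.darts := by
  have hne : p.darts ≠ [] := by
    rw [← List.length_pos_iff, p.length_darts]; exact hp
  have hpos := rotationPeriod_pos hne
  have hmem : rotationPeriod p.darts ∈ {k : ℕ | ∃ (δ : Trajectory G) (n : ℕ),
      δ.IsPrimitive ∧ p.trajectory = δ.powSucc n ∧ k = δ.length} := by
    obtain ⟨p₀, m, hlen, hpow⟩ := ClosedPath.exists_root hp hpos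
      (p.length_darts ▸ rotationPeriod_dvd_length p.darts) (rotationPeriod_dvd_iff.1 dvd_rfl)
    refine ⟨p₀.trajectory, m, ?_, hpow, hlen.symm⟩
    -- If the root were a proper power of `p₁`, the minimal period would divide the smaller positive
    -- length of `p₁`.
    rintro ⟨p₁⟩ n hn h
    change p₀.trajectory = p₁.trajectory.powSucc n at h
    have hlen' := (rotate_eq_self_of_powSucc (by omega) h).2
    rw [h, p₁.powSucc_trajectory, ClosedPath.powSucc_trajectory,
      ClosedPath.trajectory_eq_iff hp] at hpow
    simp only [ClosedPath.darts, darts_iterate] at hpow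
    obtain ⟨k, hk⟩ := hpow.symm
    have hrot : p.darts.rotate p₁.length = p.darts := by
      rw [ClosedPath.darts, ← hk, List.rotate_rotate, add_comm k, ← List.rotate_rotate,
        ← p₁.length_darts, rotate_length_eq_self_of_append_comm]
      · exact append_flatten_replicate_comm (append_flatten_replicate_comm rfl _) _
      · simp only [ClosedPath.darts, List.length_flatten, List.map_replicate, List.sum_replicate,
          smul_eq_mul]
        nlinarith [Nat.zero_le (m * ((n + 1) * p₁.2.darts.length)),
          Nat.zero_le (n * p₁.2.darts.length)]
    have hdvd := rotationPeriod_dvd_iff.2 hrot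
    have : 0 < p₁.length := by
      rcases Nat.eq_zero_or_pos p₁.length with h0 | h0
      · rw [h0] at hlen'; omega
      · exact h0
    have := Nat.le_of_dvd this hdvd
    nlinarith
  refine le_antisymm (Nat.sInf_le hmem) (le_csInf ⟨_, hmem⟩ ?_)
  rintro _ ⟨⟨p₀⟩, n, -, h, rfl⟩
  change p.trajectory = p₀.trajectory.powSucc n at h
  have h' := rotate_eq_self_of_powSucc hp h
  refine Nat.le_of_dvd ?_ (rotationPeriod_dvd_iff.2 h'.1)
  change 0 < p₀.length
  rcases Nat.eq_zero_or_pos p₀.length with h0 | h0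
  · rw [h0] at h'; omega
  · exact h0

theorem ClosedPath.image_darts_fiber {p : ClosedPath G} (hp : 0 < p.length) :
    ClosedPath.darts '' {p' | p'.trajectory = p.trajectory} = {l | p.darts ~r l} := by
  ext l
  constructor
  · rintro ⟨p', h, rfl⟩
    exact (ClosedPath.trajectory_eq_iff hp).1 (Eq.symm h)
  · rintro h
    obtain ⟨p', rfl⟩ : ∃ p' : ClosedPath G, p'.darts = l := by
      apply ClosedPath.exists_darts_eq
      · rintro rfl
        have := h.perm.length_eq
        rw [p.length_darts] at this
        simp at this; omega
      · rw [← Cycle.coe_eq_coe.2 h]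
        exact p.chain_dartAdj
    exact ⟨p', ((ClosedPath.trajectory_eq_iff hp).2 h).symm, rfl⟩

theorem ClosedPath.injOn_darts_fiber {p : ClosedPath G} (hp : 0 < p.length) :
    Set.InjOn ClosedPath.darts {p' | p'.trajectory = p.trajectory} := by
  intro p₁ h₁ p₂ _ h
  apply ClosedPath.eq_of_darts_eq h
  have : p₁.length = p.length := congrArg Trajectory.length h₁
  omega

/-- The number of closed paths with the trajectory `γ` is `Λ(γ)`. -/
theorem ClosedPath.ncard_fiber {p : ClosedPath G} (hp : 0 < p.length) :
    Set.ncard {p' : ClosedPath G | p'.trajectory = p.trajectory} =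
      p.trajectory.primitiveLength := by
  rw [ClosedPath.primitiveLength_trajectory hp, ← ncard_isRotated, ← image_darts_fiber hp,
    (injOn_darts_fiber hp).ncard_image]
  rw [← List.length_pos_iff, p.length_darts]; exact hp

theorem ClosedPath.finite_fiber {p : ClosedPath G} (hp : 0 < p.length) :
    {p' : ClosedPath G | p'.trajectory = p.trajectory}.Finite := by
  apply Set.Finite.of_finite_image _ (injOn_darts_fiber hp)
  rw [image_darts_fiber hp]
  exact finite_isRotated _

end TraceFormula

/-! ### Reduction of walks and contractible paths -/

namespace TraceFormula

open SimpleGraph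

variable {V : Type*}

/-- Prepend the vertex `v` to the list of vertices of a reduced walk, and cancel. -/
def consReduce [DecidableEq V] (v : V) : List V → List V
  | [] => [v]
  | [w] => [v, w]
  | w :: x :: l => if v = x then x :: l else v :: w :: x :: l

/-- The vertices of the walk obtained by cancelling all backtracks. -/
def reducedSupport [DecidableEq V] {G : SimpleGraph V} : ∀ {u v : V}, G.Walk u v → List V
  | u, _, .nil => [u]
  | u, _, .cons _ p => consReduce u (reducedSupport p)

/-- `l` is the list of vertices of a walk from `u` to `v` without backtracks. -/
def IsReducedSupport (G : SimpleGraph V) (v : V) : List V → Prop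
  | [] => False
  | [w] => w = v
  | [w, x] => G.Adj w x ∧ x = v
  | w :: x :: y :: l => G.Adj w x ∧ w ≠ y ∧ IsReducedSupport G v (x :: y :: l)

theorem isReducedSupport_cons_cons {G : SimpleGraph V} {v w x : V} {l : List V} :
    IsReducedSupport G v (w :: x :: l) ↔
      G.Adj w x ∧ (∀ y ∈ l.head?, w ≠ y) ∧ IsReducedSupport G v (x :: l) := by
  cases l <;> simp [IsReducedSupport]

section

variable [DecidableEq V] {G : SimpleGraph V}

theorem isReducedSupport_consReduce {u v w : V} (h : G.Adj u w) {l : List V}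
    (hl : IsReducedSupport G v l) (hw : l.head? = some w) :
    IsReducedSupport G v (consReduce u l) ∧ (consReduce u l).head? = some u := by
  match l with
  | [] => simp at hw
  | [x] =>
    obtain rfl : x = w := by simpa using hw
    exact ⟨⟨h, hl⟩, rfl⟩
  | x :: y :: l =>
    obtain rfl : x = w := by simpa using hw
    rw [consReduce]
    split_ifs with huy
    · subst huy
      exact ⟨(isReducedSupport_cons_cons.1 hl).2.2, rfl⟩
    · exact ⟨⟨h, huy, hl⟩, rfl⟩

theorem isReducedSupport_reducedSupport {u v : V} (p : G.Walk u v) :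
    IsReducedSupport G v (reducedSupport p) ∧ (reducedSupport p).head? = some u := by
  induction p with
  | nil => exact ⟨rfl, rfl⟩
  | cons h p ih => exact isReducedSupport_consReduce h ih.1 ih.2

theorem consReduce_eq_singleton_iff {u v w : V} (h : G.Adj u w) {l : List V}
    (hl : IsReducedSupport G v l) (hw : l.head? = some w) :
    consReduce u l = [u] ↔ l = [w, u] := by
  match l with
  | [] => simp at hw
  | [x] => simp [consReduce]
  | x :: y :: l =>
    obtain rfl : x = w := by simpa using hw
    rw [consReduce]
    grind

/-- For each first step `u → w`, exactly one reduced form of the remaining walk is possible: one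
vertex shorter if `w = z`, one longer otherwise. This is the step of the tree recursion. -/
theorem consReduce_eq_cons_cons_iff {u v w z : V} {s : List V} (h : G.Adj u w) {l : List V}
    (hs : IsReducedSupport G v (u :: z :: s))
    (hl : IsReducedSupport G v l) (hw : l.head? = some w) :
    consReduce u l = u :: z :: s ↔ if w = z then l = z :: s else l = w :: u :: z :: s := by
  match l with
  | [] => simp at hw
  | [x] =>
    obtain rfl : x = w := by simpa using hw
    simp only [consReduce]
    split_ifs <;> grind
  | x :: y :: l =>
    obtain rfl : x = w := by simpa using hw
    rw [consReduce]
    rw [isReducedSupport_cons_cons] at hl hs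
    split_ifs <;> cases s <;> cases l <;> grind

variable [Fintype V] [DecidableRel G.Adj]

theorem card_filter_finsetWalkLength_succ {n : ℕ} {u v : V} {s : List V} :
    ((G.finsetWalkLength (n + 1) u v).filter (fun p => reducedSupport p = s)).card =
      ∑ w ∈ G.neighborFinset u,
        ((G.finsetWalkLength n w v).filter
          (fun p => consReduce u (reducedSupport p) = s)).card := by
  rw [finsetWalkLength, Finset.filter_biUnion, Finset.card_biUnion,
    Finset.sum_subtype (p := (· ∈ G.neighborSet u)) _ (fun w => by simp)]
  · refine Finset.sum_congr rfl fun w _ => ?_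
    rw [Finset.filter_map, Finset.card_map]
    rfl
  · intro w _ w' _ hne
    rw [Function.onFun, Finset.disjoint_left]
    intro p hp hp'
    simp only [Finset.mem_filter, Finset.mem_map] at hp hp'
    obtain ⟨⟨r, -, rfl⟩, -⟩ := hp
    obtain ⟨⟨r', -, h⟩, -⟩ := hp'
    injection h with _ h
    exact hne (Subtype.ext h.symm)

/-- The number of walks with a given reduced form depends only on its length. -/
theorem card_filter_reducedSupport {q : ℕ} (hreg : G.IsRegularOfDegree (q + 1)) (n : ℕ)
    {u v : V} {k : ℕ} {s : List V} (hs : IsReducedSupport G v (u :: s)) (hk : s.length = k) :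
    ((G.finsetWalkLength n u v).filter (fun p => reducedSupport p = u :: s)).card =
      treeWalkCount q n k := by
  induction n generalizing u k s with
  | zero =>
    subst hk
    cases s with
    | nil =>
      obtain rfl : u = v := hs
      simp [finsetWalkLength, reducedSupport, treeWalkCount, Finset.filter_singleton]
    | cons z s =>
      rw [List.length_cons, treeWalkCount, Finset.card_eq_zero, Finset.filter_eq_empty_iff]
      intro p hp
      rw [mem_finsetWalkLength_iff] at hp
      cases p with
      | nil => simp [reducedSupport]
      | cons h p => simp at hp
  | succ n ih =>
    rw [card_filter_finsetWalkLength_succ]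
    cases s with
    | nil =>
      obtain rfl : u = v := hs
      subst hk
      rw [List.length_nil, treeWalkCount, ← hreg u, ← card_neighborFinset_eq_degree,
        ← smul_eq_mul]
      apply Finset.sum_eq_card_nsmul
      intro w hw
      rw [mem_neighborFinset] at hw
      rw [← ih (u := w) (k := 1) (s := [u]) ⟨hw.symm, rfl⟩ rfl]
      congr 1
      ext p
      have := isReducedSupport_reducedSupport p
      simp [consReduce_eq_singleton_iff hw this.1 this.2]
    | cons z s =>
      subst hk
      have hs' := isReducedSupport_cons_cons.1 hs
      have hz : z ∈ G.neighborFinset u := by simpa using hs'.1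
      rw [List.length_cons, treeWalkCount, ← Finset.add_sum_erase _ _ hz]
      congr 1
      · rw [← ih hs'.2.2 rfl]
        congr 1
        ext p
        have := isReducedSupport_reducedSupport p
        simp [consReduce_eq_cons_cons_iff hs'.1 hs this.1 this.2]
      · have hcard : ((G.neighborFinset u).erase z).card = q := by
          rw [Finset.card_erase_of_mem hz, card_neighborFinset_eq_degree, hreg u]; rfl
        rw [← hcard, ← smul_eq_mul]
        apply Finset.sum_eq_card_nsmul
        intro w hw
        rw [Finset.mem_erase, mem_neighborFinset] at hw
        rw [hcard, ← ih (u := w) (k := s.length + 2) (s := u :: z :: s)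
          (isReducedSupport_cons_cons.2 ⟨hw.2.symm, by simpa using hw.1, hs⟩) rfl]
        congr 1
        ext p
        have := isReducedSupport_reducedSupport p
        simp [consReduce_eq_cons_cons_iff hw.2 hs this.1 this.2, hw.1]

end

/-- The element of a free group attached to a step. -/
def stepElement (v w : V) : FreeGroup (V × V) := FreeGroup.of (v, w) * (FreeGroup.of (w, v))⁻¹

/-- Two generators per edge make reversal an inversion without choosing an orientation. -/
theorem stepElement_swap (v w : V) : stepElement w v = (stepElement v w)⁻¹ := by
  simp [stepElement]

/-- The element of a free group attached to a walk. -/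
def walkElement {G : SimpleGraph V} : ∀ {u v : V}, G.Walk u v → FreeGroup (V × V)
  | _, _, .nil => 1
  | _, _, .cons (u := u) (v := w) _ p => stepElement u w * walkElement p

theorem walkElement_append {G : SimpleGraph V} {u v w : V} (p : G.Walk u v) (r : G.Walk v w) :
    walkElement (p.append r) = walkElement p * walkElement r := by
  induction p with
  | nil => simp [walkElement]
  | cons h p ih => simp [walkElement, ih, mul_assoc]

/-- The conjugacy class attached to a trajectory. -/
def trajectoryClass {G : SimpleGraph V} : Trajectory G → ConjClasses (FreeGroup (V × V)) :=
  Quot.lift (fun p => ConjClasses.mk (walkElement p.2)) (by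
    rintro _ _ ⟨p, r⟩
    rw [ConjClasses.mk_eq_mk_iff_isConj, walkElement_append, walkElement_append, isConj_iff]
    exact ⟨(walkElement p)⁻¹, by group⟩)

/-- A backtrack contributes an element times its inverse. -/
theorem trajectoryClass_eq_of_homotopy {G : SimpleGraph V} {γ δ : Trajectory G}
    (h : Relation.EqvGen (ElementaryHomotopy G) γ δ) : trajectoryClass γ = trajectoryClass δ := by
  induction h with
  | rel _ _ h =>
    obtain ⟨p, r, h⟩ := h
    change ConjClasses.mk _ = ConjClasses.mk _
    congr 1
    simp only [walkElement_append, walkElement]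
    rw [← mul_assoc (stepElement _ _), stepElement_swap, inv_mul_cancel, one_mul]
  | refl => rfl
  | symm _ _ _ ih => exact ih.symm
  | trans _ _ _ _ _ ih₁ ih₂ => exact ih₁.trans ih₂

theorem walkElement_eq_one_of_contractible {G : SimpleGraph V} {p : ClosedPath G}
    (hp : p ∈ contractiblePaths G) : walkElement p.2 = 1 := by
  obtain ⟨⟨u, p₀⟩, hlen, h⟩ := hp
  have h' := trajectoryClass_eq_of_homotopy h
  cases p₀ with
  | cons h p => simp [ClosedPath.length] at hlen
  | nil =>
    have : ConjClasses.mk (walkElement p.2) = ConjClasses.mk 1 := h'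
    rwa [ConjClasses.mk_eq_mk_iff_isConj, isConj_one_left] at this

/-- The element of a free group attached to a list of vertices. -/
def listWord : List V → List ((V × V) × Bool)
  | v :: w :: l => ((v, w), true) :: ((w, v), false) :: listWord (w :: l)
  | _ => []

theorem mk_listWord_cons_cons (u w : V) (l : List V) :
    FreeGroup.mk (listWord (u :: w :: l)) = stepElement u w * FreeGroup.mk (listWord (w :: l)) := by
  simp [listWord, stepElement, FreeGroup.of, FreeGroup.mul_mk, FreeGroup.invRev]

/-- Neighbouring letters could cancel only if `(w, x) = (x, w)`, a loop, or `(x, w) = (x, y)`, a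
backtrack. -/
theorem isReduced_listWord {G : SimpleGraph V} {v : V} {l : List V}
    (hl : IsReducedSupport G v l) : FreeGroup.IsReduced (listWord l) := by
  match l with
  | [] => exact FreeGroup.IsReduced.nil
  | [_] => exact FreeGroup.IsReduced.nil
  | [w, x] =>
    have h : w ≠ x := hl.1.ne
    simp [listWord, FreeGroup.IsReduced, h]
  | w :: x :: y :: l =>
    have h : w ≠ x := hl.1.ne
    have ih := isReduced_listWord hl.2.2
    rw [listWord] at ih ⊢
    rw [listWord, FreeGroup.isReduced_cons_cons, FreeGroup.isReduced_cons_cons]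
    refine ⟨?_, ?_, ih⟩ <;> simp [h, hl.2.1]

section

variable [DecidableEq V] {G : SimpleGraph V}

theorem mk_listWord_consReduce (u w : V) {l : List V} (hw : l.head? = some w) :
    FreeGroup.mk (listWord (consReduce u l)) = stepElement u w * FreeGroup.mk (listWord l) := by
  match l with
  | [] => simp at hw
  | [x] =>
    obtain rfl : x = w := by simpa using hw
    exact mk_listWord_cons_cons u x []
  | x :: y :: l =>
    obtain rfl : x = w := by simpa using hw
    rw [consReduce]
    split_ifs with h
    · subst h
      rw [mk_listWord_cons_cons, ← mul_assoc, stepElement_swap, inv_mul_cancel, one_mul]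
    · exact mk_listWord_cons_cons u x (y :: l)

theorem mk_listWord_reducedSupport {u v : V} (p : G.Walk u v) :
    FreeGroup.mk (listWord (reducedSupport p)) = walkElement p := by
  induction p with
  | nil => rfl
  | cons h p ih =>
    rw [reducedSupport, mk_listWord_consReduce _ _ (isReducedSupport_reducedSupport p).2, ih,
      walkElement]

theorem reducedSupport_eq_of_walkElement_eq_one {u v : V} (p : G.Walk u v)
    (h : walkElement p = 1) : reducedSupport p = [u] := by
  have hp := isReducedSupport_reducedSupport p
  rw [← mk_listWord_reducedSupport, ← FreeGroup.toWord_eq_nil_iff, FreeGroup.toWord_mk,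
    (isReduced_listWord hp.1).reduce_eq] at h
  match hr : reducedSupport p with
  | [] => rw [hr] at hp; simp at hp
  | [w] => rw [hr] at hp; simpa using hp.2
  | w :: x :: l => rw [hr] at h; simp [listWord] at h

/-- Every walk can be replaced by its reduction inside a closed path without changing the
homotopy class. -/
theorem exists_reduced_walk {u v : V} (p : G.Walk u v) :
    ∃ p' : G.Walk u v, p'.support = reducedSupport p ∧ ∀ {x : V} (s : G.Walk x u) (r : G.Walk v x),
      Relation.EqvGen (ElementaryHomotopy G) (ClosedPath.trajectory ⟨x, s.append (p.append r)⟩)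
        (ClosedPath.trajectory ⟨x, s.append (p'.append r)⟩) := by
  induction p with
  | nil => exact ⟨.nil, rfl, fun _ _ => .refl _⟩
  | cons h p ih =>
    rename_i u w v
    obtain ⟨p', hp', H⟩ := ih
    have H' {x : V} (s : G.Walk x u) (r : G.Walk v x) :
        Relation.EqvGen (ElementaryHomotopy G)
          (ClosedPath.trajectory ⟨x, s.append ((Walk.cons h p).append r)⟩)
          (ClosedPath.trajectory ⟨x, s.append ((Walk.cons h p').append r)⟩) := by
      -- The first step is moved into the left context, which is why the claim quantifies over `s`
      -- and `r`.
      have := H (s.append h.toWalk) r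
      rwa [← Walk.append_assoc, ← Walk.append_assoc] at this
    cases p' with
    | nil => exact ⟨.cons h .nil, by rw [reducedSupport, ← hp']; rfl, H'⟩
    | cons h₂ p₂ =>
      rename_i y
      rw [Walk.support_cons, ← Walk.cons_tail_support] at hp'
      by_cases huy : u = y
      · subst huy
        refine ⟨p₂, ?_, fun s r => (H' s r).trans _ _ _ (.symm _ _ (.rel _ _ ?_))⟩
        · rw [reducedSupport, ← hp', consReduce, if_pos rfl, Walk.cons_tail_support]
        · exact ElementaryHomotopy.insert s (p₂.append r) h
      · refine ⟨.cons h (.cons h₂ p₂), ?_, H'⟩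
        rw [reducedSupport, ← hp', consReduce, if_neg huy, Walk.support_cons, Walk.support_cons,
          Walk.cons_tail_support]

/-- The free group invariant gives one direction; carrying out the cancellations as homotopies gives
the other. -/
theorem mem_contractiblePaths_iff {p : ClosedPath G} :
    p ∈ contractiblePaths G ↔ reducedSupport p.2 = [p.1] := by
  constructor
  · intro h
    exact reducedSupport_eq_of_walkElement_eq_one _ (walkElement_eq_one_of_contractible h)
  · intro h
    obtain ⟨p', hp', H⟩ := exists_reduced_walk p.2
    refine ⟨⟨p.1, p'⟩, ?_, ?_⟩
    · have := p'.length_support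
      rw [hp', h] at this
      simpa [ClosedPath.length] using this.symm
    · have := H .nil .nil
      simpa [Homotopic] using this

/-- The number of contractible closed paths of length `n`. -/
theorem ncard_contractiblePaths [Fintype V] [DecidableRel G.Adj] {q : ℕ}
    (hreg : G.IsRegularOfDegree (q + 1)) (n : ℕ) :
    Set.ncard {p : ClosedPath G | p ∈ contractiblePaths G ∧ p.length = n} =
      Fintype.card V * treeWalkCount q n 0 := by
  have h : {p : ClosedPath G | p ∈ contractiblePaths G ∧ p.length = n} =
      (Finset.univ.sigma fun v => (G.finsetWalkLength n v v).filter
        (fun p => reducedSupport p = [v]) : Finset (ClosedPath G)) := by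
    ext p
    simp [mem_contractiblePaths_iff, mem_finsetWalkLength_iff, ClosedPath.length, and_comm]
  rw [h, Set.ncard_coe_finset, Finset.card_sigma]
  simp [card_filter_reducedSupport hreg n (k := 0) (s := [])
    (show IsReducedSupport G _ [_] from rfl)]

end

end TraceFormula

/-! ### Moments of the Kesten–McKay density -/

namespace TraceFormula

open MeasureTheory

/-- The density of the contribution of the contractible paths. -/
noncomputable def treeDensity (q : ℕ) (s : ℝ) : ℝ := √(4 * q - s ^ 2) / ((q + 1) ^ 2 - s ^ 2)

/-- The moments of `treeDensity`. -/
noncomputable def treeMoment (q n : ℕ) : ℝ :=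
  ∫ s in (-(2 * √(q : ℝ)))..(2 * √(q : ℝ)), s ^ n * treeDensity q s

/-- The moments of the semicircle density. -/
noncomputable def semicircleMoment (q n : ℕ) : ℝ :=
  ∫ s in (-(2 * √(q : ℝ)))..(2 * √(q : ℝ)), s ^ n * √(4 * q - s ^ 2)

theorem four_mul_sub_sq_nonneg {q : ℕ} {s : ℝ}
    (hs : s ∈ Set.Icc (-(2 * √(q : ℝ))) (2 * √(q : ℝ))) : 0 ≤ 4 * (q : ℝ) - s ^ 2 := by
  have h := Real.sq_sqrt (Nat.cast_nonneg (α := ℝ) q)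
  nlinarith [mul_nonneg (sub_nonneg.2 hs.2) (neg_le_iff_add_nonneg.1 hs.1)]

theorem four_mul_sub_sq_pos {q : ℕ} {s : ℝ}
    (hs : s ∈ Set.Ioo (-(2 * √(q : ℝ))) (2 * √(q : ℝ))) : 0 < 4 * (q : ℝ) - s ^ 2 := by
  have h := Real.sq_sqrt (Nat.cast_nonneg (α := ℝ) q)
  nlinarith [mul_pos (sub_pos.2 hs.2) (neg_lt_iff_pos_add.1 hs.1)]

theorem uIcc_two_mul_sqrt (q : ℕ) : Set.uIcc (-(2 * √(q : ℝ))) (2 * √(q : ℝ)) =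
    Set.Icc (-(2 * √(q : ℝ))) (2 * √(q : ℝ)) :=
  Set.uIcc_of_le (by have := Real.sqrt_nonneg (q : ℝ); linarith)

theorem treeDensity_nonneg {q : ℕ} {s : ℝ}
    (hs : s ∈ Set.Icc (-(2 * √(q : ℝ))) (2 * √(q : ℝ))) : 0 ≤ treeDensity q s := by
  have h := four_mul_sub_sq_nonneg hs
  refine div_nonneg (Real.sqrt_nonneg _) ?_
  nlinarith [sq_nonneg ((q : ℝ) - 1)]

/-- For `q = 1` the poles of the density meet the end points of the interval and it becomes the
arcsine density, which is unbounded; this case is treated through an explicit primitive. -/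
theorem treeDensity_one (s : ℝ) : treeDensity 1 s = (√(4 - s ^ 2))⁻¹ := by
  rw [treeDensity, ← Real.sqrt_div_self]
  norm_num

theorem hasDerivAt_arcsin_half {s : ℝ} (hs : s ∈ Set.Ioo (-2 : ℝ) 2) :
    HasDerivAt (fun s : ℝ => Real.arcsin (s / 2)) (√(4 - s ^ 2))⁻¹ s := by
  have h1 : s / 2 ≠ -1 := by have := hs.1; intro h; linarith
  have h2 : s / 2 ≠ 1 := by have := hs.2; intro h; linarith
  have := (Real.hasDerivAt_arcsin h1 h2).comp s ((hasDerivAt_id s).div_const 2)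
  refine this.congr_deriv ?_
  have h4 : √(4 - s ^ 2) = 2 * √(1 - (s / 2) ^ 2) := by
    rw [show (4 - s ^ 2 : ℝ) = 2 ^ 2 * (1 - (s / 2) ^ 2) by ring, Real.sqrt_mul (by norm_num),
      Real.sqrt_sq (by norm_num)]
  rw [h4, mul_inv]
  ring

theorem intervalIntegrable_inv_sqrt :
    IntervalIntegrable (fun s : ℝ => (√(4 - s ^ 2))⁻¹) volume (-2) 2 := by
  apply intervalIntegral.intervalIntegrable_deriv_of_nonneg
    (g := fun s : ℝ => Real.arcsin (s / 2))
  · exact (Real.continuous_arcsin.comp (continuous_id.div_const 2)).continuousOn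
  · intro s hs
    exact hasDerivAt_arcsin_half (by simpa using hs)
  · intro s _
    positivity

theorem integral_inv_sqrt : ∫ s in (-2 : ℝ)..2, (√(4 - s ^ 2))⁻¹ = Real.pi := by
  rw [intervalIntegral.integral_eq_sub_of_hasDerivAt_of_le (by norm_num)
    (Real.continuous_arcsin.comp (continuous_id.div_const 2)).continuousOn
    (fun s hs => hasDerivAt_arcsin_half hs) intervalIntegrable_inv_sqrt]
  norm_num [Real.arcsin_one]

theorem intervalIntegrable_treeDensity {q : ℕ} (hq : 1 ≤ q) :
    IntervalIntegrable (treeDensity q) volume (-(2 * √(q : ℝ))) (2 * √(q : ℝ)) := by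
  rcases hq.eq_or_lt with rfl | hq
  · simp only [Nat.cast_one, Real.sqrt_one, mul_one]
    exact intervalIntegrable_inv_sqrt.congr (fun s _ => (treeDensity_one s).symm)
  · apply ContinuousOn.intervalIntegrable
    rw [uIcc_two_mul_sqrt]
    apply ContinuousOn.div (by fun_prop) (by fun_prop)
    intro s hs
    have h := four_mul_sub_sq_nonneg hs
    have hq' : (1 : ℝ) < q := by exact_mod_cast hq
    nlinarith [mul_pos (sub_pos.2 hq') (sub_pos.2 hq')]

theorem intervalIntegrable_pow_mul_treeDensity {q : ℕ} (hq : 1 ≤ q) (n : ℕ) :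
    IntervalIntegrable (fun s => s ^ n * treeDensity q s) volume
      (-(2 * √(q : ℝ))) (2 * √(q : ℝ)) :=
  (intervalIntegrable_treeDensity hq).continuousOn_mul (by fun_prop)

theorem intervalIntegrable_ofReal {f : ℝ → ℝ} {a b : ℝ} (h : IntervalIntegrable f volume a b) :
    IntervalIntegrable (fun s => (f s : ℂ)) volume a b :=
  ⟨h.1.ofReal, h.2.ofReal⟩

theorem integral_odd {f : ℝ → ℝ} (hf : ∀ s, f (-s) = -f s) (a : ℝ) : ∫ s in -a..a, f s = 0 := by
  have h := intervalIntegral.integral_comp_neg (f := f) (a := -a) (b := a)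
  simp only [hf, intervalIntegral.integral_neg, neg_neg] at h
  linarith

theorem treeMoment_odd {q n : ℕ} (hn : Odd n) : treeMoment q n = 0 :=
  integral_odd (fun s => by simp [treeDensity, hn.neg_pow]) _

theorem treeMoment_recursion {q : ℕ} (hq : 1 ≤ q) (n : ℕ) :
    (q + 1) ^ 2 * treeMoment q n - treeMoment q (n + 2) = semicircleMoment q n := by
  rw [treeMoment, treeMoment, semicircleMoment, ← intervalIntegral.integral_const_mul,
    ← intervalIntegral.integral_sub
      ((intervalIntegrable_pow_mul_treeDensity hq n).const_mul _)
      (intervalIntegrable_pow_mul_treeDensity hq (n + 2))]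
  apply intervalIntegral.integral_congr
  intro s hs
  rw [uIcc_two_mul_sqrt] at hs
  have h := four_mul_sub_sq_nonneg hs
  simp only [treeDensity]
  -- As `(q + 1) ^ 2 ≥ 4 q ≥ s ^ 2`, a zero denominator forces the square root to vanish too, so the
  -- default value of division does no harm.
  by_cases hd : ((q : ℝ) + 1) ^ 2 - s ^ 2 = 0
  · have h0 : 4 * (q : ℝ) - s ^ 2 = 0 := by nlinarith [sq_nonneg ((q : ℝ) - 1)]
    simp [h0]
  · field_simp
    ring

theorem semicircleMoment_zero {q : ℕ} (hq : 1 ≤ q) : semicircleMoment q 0 = 2 * Real.pi * q := by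
  have hq' : (0 : ℝ) < q := by exact_mod_cast hq
  have h2 : 2 * √(q : ℝ) ≠ 0 := by positivity
  have hsq := Real.sq_sqrt hq'.le
  have h := intervalIntegral.integral_comp_mul_left (a := -1) (b := 1)
    (fun s : ℝ => √(4 * q - s ^ 2)) h2
  have h' : ∀ x : ℝ, √(4 * q - (2 * √(q : ℝ) * x) ^ 2) = 2 * √(q : ℝ) * √(1 - x ^ 2) := by
    intro x
    rw [show 4 * (q : ℝ) - (2 * √(q : ℝ) * x) ^ 2 = (2 * √(q : ℝ)) ^ 2 * (1 - x ^ 2) by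
      rw [mul_pow, mul_pow, hsq]; ring, Real.sqrt_mul (by positivity),
      Real.sqrt_sq (by positivity)]
  simp only [h', intervalIntegral.integral_const_mul, integral_sqrt_one_sub_sq, mul_neg, mul_one,
    smul_eq_mul] at h
  rw [eq_inv_mul_iff_mul_eq₀ h2] at h
  simp only [semicircleMoment, pow_zero, one_mul]
  rw [← h]
  linear_combination 2 * Real.pi * hsq

/-- Integrate the derivative of `s ^ (n + 1) (4 q - s ^ 2) ^ (3 / 2)`, which vanishes at both end
points. -/
theorem semicircleMoment_add_two (q n : ℕ) :
    (n + 4) * semicircleMoment q (n + 2) = 4 * q * (n + 1) * semicircleMoment q n := by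
  have hle : -(2 * √(q : ℝ)) ≤ 2 * √(q : ℝ) := by
    have := Real.sqrt_nonneg (q : ℝ); linarith
  have hint : ∀ m : ℕ, IntervalIntegrable (fun s : ℝ => s ^ m * √(4 * q - s ^ 2)) volume
      (-(2 * √(q : ℝ))) (2 * √(q : ℝ)) := fun m =>
    Continuous.intervalIntegrable (by fun_prop) _ _
  have hderiv : ∀ s ∈ Set.Ioo (-(2 * √(q : ℝ))) (2 * √(q : ℝ)),
      HasDerivAt (fun s : ℝ => s ^ (n + 1) * ((4 * q - s ^ 2) * √(4 * q - s ^ 2)))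
        (4 * q * (n + 1) * (s ^ n * √(4 * q - s ^ 2)) -
          (n + 4) * (s ^ (n + 2) * √(4 * q - s ^ 2))) s := by
    intro s hs
    have hpos := four_mul_sub_sq_pos hs
    have hsq := Real.sq_sqrt hpos.le
    have hne := (Real.sqrt_pos.2 hpos).ne'
    have h1 : HasDerivAt (fun s : ℝ => 4 * (q : ℝ) - s ^ 2) (-(2 * s)) s := by
      simpa using (hasDerivAt_pow 2 s).const_sub (4 * (q : ℝ))
    have h2 := (hasDerivAt_pow (n + 1) s).mul (h1.mul (h1.sqrt hpos.ne'))
    refine h2.congr_deriv ?_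
    simp only [Pi.mul_apply]
    set r := √(4 * (q : ℝ) - s ^ 2)
    have hr : (4 * (q : ℝ) - s ^ 2) * (-(2 * s) / (2 * r)) = -(s * r) := by
      rw [← hsq]; field_simp
    rw [hr]
    simp only [Nat.add_sub_cancel]
    push_cast
    ring
  have h := intervalIntegral.integral_eq_sub_of_hasDerivAt_of_le hle (by fun_prop) hderiv
    (((hint n).const_mul _).sub ((hint (n + 2)).const_mul _))
  rw [intervalIntegral.integral_sub ((hint n).const_mul _) ((hint (n + 2)).const_mul _),
    intervalIntegral.integral_const_mul, intervalIntegral.integral_const_mul] at h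
  have h0 : 4 * (q : ℝ) - (2 * √(q : ℝ)) ^ 2 = 0 := by
    rw [mul_pow, Real.sq_sqrt (Nat.cast_nonneg q)]; ring
  simp only [neg_sq, h0, zero_mul, mul_zero, sub_self] at h
  rw [semicircleMoment, semicircleMoment]
  linarith

theorem semicircleMoment_two_mul {q : ℕ} (hq : 1 ≤ q) (k : ℕ) :
    (k + 1) * semicircleMoment q (2 * k) = 2 * Real.pi * q * (q ^ k * k.centralBinom) := by
  induction k with
  | zero => simp [semicircleMoment_zero hq]
  | succ k ih =>
    have h1 := semicircleMoment_add_two q (2 * k)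
    have h2 : ((k : ℝ) + 1) * (k + 1).centralBinom = 2 * (2 * k + 1) * k.centralBinom := by
      exact_mod_cast Nat.succ_mul_centralBinom_succ k
    have hk : (k : ℝ) + 1 ≠ 0 := by positivity
    apply mul_left_cancel₀ hk
    rw [show 2 * (k + 1) = 2 * k + 2 by ring]
    push_cast at h1 ⊢
    rw [pow_succ]
    linear_combination ((k : ℝ) + 1) / 2 * h1 + 2 * q * (2 * k + 1) * ih -
      2 * Real.pi * q * q ^ k * q * h2

/-- The difference equals `c_0 - q c_2`, a Catalan number times `q ^ k`; `semicircleMoment_two_mul`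
produces the same number. -/
theorem treeWalkCount_sub (q k : ℕ) :
    ((k : ℝ) + 1) * ((treeWalkCount q (2 * k) 0 : ℝ) - treeWalkCount q (2 * k) 2) =
      q ^ k * k.centralBinom := by
  have h := treeWalkCount_add_eq_chebCoeff_add q (2 * k) 0
  have h' : (treeWalkCount q (2 * k) 0 : ℝ) - treeWalkCount q (2 * k) 2 =
      chebCoeff q (2 * k) 0 - q * chebCoeff q (2 * k) 2 := by
    have : (treeWalkCount q (2 * k) 0 : ℝ) + q * chebCoeff q (2 * k) 2 =
      treeWalkCount q (2 * k) 2 + chebCoeff q (2 * k) 0 := by exact_mod_cast h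
    linarith
  have h0 : chebCoeff q (2 * k) 0 = k.centralBinom * q ^ k := chebCoeff_two_mul_add q k 0
  rw [h', h0]
  cases k with
  | zero => simp [chebCoeff]
  | succ j =>
    have h2 : chebCoeff q (2 * (j + 1)) 2 = (2 * (j + 1)).choose j * q ^ j :=
      chebCoeff_two_mul_add q j 2
    have h3 := Nat.choose_succ_right_eq (2 * (j + 1)) j
    rw [show 2 * (j + 1) - j = j + 2 by omega, ← Nat.centralBinom_eq_two_mul_choose] at h3
    have h4 : ((j + 1).centralBinom : ℝ) * (j + 1) = (2 * (j + 1)).choose j * (j + 2) := by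
      exact_mod_cast h3
    rw [h2]
    push_cast
    rw [pow_succ]
    linear_combination (q : ℝ) ^ j * q * h4

theorem treeWalkCount_recursion (q n : ℕ) :
    ((q : ℝ) + 1) ^ 2 * treeWalkCount q n 0 - treeWalkCount q (n + 2) 0 =
      (q + 1) * (q * (treeWalkCount q n 0 - treeWalkCount q n 2)) := by
  rw [treeWalkCount, treeWalkCount]
  push_cast
  ring

theorem semicircleMoment_eq {q : ℕ} (hq : 1 ≤ q) (k : ℕ) :
    semicircleMoment q (2 * k) =
      2 * Real.pi * (q * (treeWalkCount q (2 * k) 0 - treeWalkCount q (2 * k) 2)) := by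
  have hk : (k : ℝ) + 1 ≠ 0 := by positivity
  apply mul_left_cancel₀ hk
  rw [semicircleMoment_two_mul hq]
  linear_combination -2 * Real.pi * q * treeWalkCount_sub q k

/-- The normalized moments and the walk counts obey `x_{k+1} = (q + 1) ^ 2 x_k - b_k` with the same
`b_k`, so their difference is geometric. -/
theorem treeMoment_sub {q : ℕ} (hq : 1 ≤ q) (k : ℕ) :
    (q + 1) / (2 * Real.pi) * treeMoment q (2 * k) - treeWalkCount q (2 * k) 0 =
      ((q + 1) ^ 2) ^ k * ((q + 1) / (2 * Real.pi) * treeMoment q 0 - 1) := by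
  induction k with
  | zero => simp [treeWalkCount]
  | succ k ih =>
    have h1 := treeMoment_recursion hq (2 * k)
    have h2 := treeWalkCount_recursion q (2 * k)
    rw [semicircleMoment_eq hq] at h1
    have hpi := Real.pi_ne_zero
    have hc : ((q : ℝ) + 1) / (2 * Real.pi) * (2 * Real.pi) = q + 1 := by field_simp
    rw [show 2 * (k + 1) = 2 * k + 2 by ring, pow_succ]
    linear_combination -((q : ℝ) + 1) / (2 * Real.pi) * h1 + h2 + ((q : ℝ) + 1) ^ 2 * ih -
      q * (treeWalkCount q (2 * k) 0 - treeWalkCount q (2 * k) 2) * hc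

theorem treeMoment_even_le {q : ℕ} (hq : 1 ≤ q) (k : ℕ) :
    |treeMoment q (2 * k)| ≤ (4 * q) ^ k * treeMoment q 0 := by
  have hle : -(2 * √(q : ℝ)) ≤ 2 * √(q : ℝ) := by
    have := Real.sqrt_nonneg (q : ℝ); linarith
  have h0 : ∀ s ∈ Set.Icc (-(2 * √(q : ℝ))) (2 * √(q : ℝ)), 0 ≤ s ^ (2 * k) * treeDensity q s :=
    fun s hs => mul_nonneg (by rw [pow_mul]; positivity) (treeDensity_nonneg hs)
  rw [treeMoment, treeMoment, abs_of_nonneg (intervalIntegral.integral_nonneg hle h0),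
    ← intervalIntegral.integral_const_mul]
  apply intervalIntegral.integral_mono_on hle (intervalIntegrable_pow_mul_treeDensity hq _)
    ((intervalIntegrable_pow_mul_treeDensity hq _).const_mul _)
  intro s hs
  rw [pow_zero, one_mul, pow_mul]
  have := four_mul_sub_sq_nonneg hs
  exact mul_le_mul_of_nonneg_right (pow_le_pow_left₀ (sq_nonneg s) (by linarith) k)
    (treeDensity_nonneg hs)

/-- For `q > 1` the error at index `k` is `(q + 1) ^ (2 k)` times the initial error, yet moments and
walk counts are both `O((4 q) ^ k)` and `4 q < (q + 1) ^ 2`; the initial error must vanish. -/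
theorem treeMoment_zero {q : ℕ} (hq : 1 ≤ q) :
    (q + 1) / (2 * Real.pi) * treeMoment q 0 = 1 := by
  have hpi := Real.pi_pos
  rcases hq.eq_or_lt with rfl | hq'
  · have : treeMoment 1 0 = Real.pi := by
      simp only [treeMoment, Nat.cast_one, Real.sqrt_one, mul_one, pow_zero, one_mul,
        treeDensity_one, integral_inv_sqrt]
    rw [this]
    field_simp
    norm_num
  · rw [← sub_eq_zero, ← abs_eq_zero]
    apply le_antisymm _ (abs_nonneg _)
    set C : ℝ := (q + 1) / (2 * Real.pi) * treeMoment q 0 + 1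
    have hq1 : (1 : ℝ) < q := by exact_mod_cast hq'
    have hr : 4 * (q : ℝ) / (q + 1) ^ 2 < 1 := by
      rw [div_lt_one (by positivity)]
      nlinarith [mul_pos (sub_pos.2 hq1) (sub_pos.2 hq1)]
    have hlim : Filter.Tendsto (fun k : ℕ => C * (4 * (q : ℝ) / (q + 1) ^ 2) ^ k) Filter.atTop
        (nhds 0) := by
      simpa using (tendsto_pow_atTop_nhds_zero_of_lt_one (by positivity) hr).const_mul C
    refine ge_of_tendsto' hlim fun k => ?_
    have h1 := treeMoment_sub hq k
    have h2 := treeMoment_even_le hq k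
    have h3 : (treeWalkCount q (2 * k) 0 : ℝ) ≤ (4 * q) ^ k := by
      have h4 : chebCoeff q (2 * k) 0 = k.centralBinom * q ^ k := chebCoeff_two_mul_add q k 0
      have h5 := treeWalkCount_le_chebCoeff hq (2 * k) 0
      have h6 : k.centralBinom * q ^ k ≤ 4 ^ k * q ^ k :=
        Nat.mul_le_mul_right _ (Nat.centralBinom_le_four_pow k)
      rw [mul_pow]
      exact_mod_cast (h5.trans_eq h4).trans h6
    have hpow : (0 : ℝ) < ((q + 1) ^ 2) ^ k := by positivity
    rw [div_pow, mul_div_assoc', le_div_iff₀ hpow, mul_comm, ← abs_of_pos hpow, ← abs_mul, ← h1]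
    refine (abs_sub _ _).trans ?_
    rw [abs_mul, abs_of_pos (show 0 < ((q : ℝ) + 1) / (2 * Real.pi) by positivity), Nat.abs_cast]
    have := mul_le_mul_of_nonneg_left h2
      (show 0 ≤ ((q : ℝ) + 1) / (2 * Real.pi) by positivity)
    simp only [C]
    nlinarith

/-- The moments of the density count the closed walks on the regular tree. -/
theorem treeMoment_eq {q : ℕ} (hq : 1 ≤ q) (n : ℕ) :
    (q + 1) / (2 * Real.pi) * treeMoment q n = treeWalkCount q n 0 := by
  rcases Nat.even_or_odd n with h | h
  · obtain ⟨k, rfl⟩ := even_iff_exists_two_mul.1 h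
    have := treeMoment_sub hq k
    rw [treeMoment_zero hq, sub_self, mul_zero] at this
    linarith
  · rw [treeMoment_odd h, treeWalkCount_eq_zero_of_odd (by simpa using h)]
    simp

theorem contractibleIntegrand_eq (q : ℕ) (t : ℂ) (s : ℝ) :
    contractibleIntegrand q t s = Complex.exp (s * t) * (treeDensity q s : ℂ) := rfl

theorem intervalIntegrable_contractibleIntegrand {q : ℕ} (hq : 1 ≤ q) (t : ℂ) :
    IntervalIntegrable (contractibleIntegrand q t) volume
      (-(2 * √(q : ℝ))) (2 * √(q : ℝ)) :=
  IntervalIntegrable.continuousOn_mul (intervalIntegrable_ofReal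
    (intervalIntegrable_treeDensity hq)) (by fun_prop)

/-- The power series expansion of the contribution of the contractible paths. -/
theorem hasSum_treeWalkCount {q : ℕ} (hq : 1 ≤ q) (t : ℂ) :
    HasSum (fun n : ℕ => (treeWalkCount q n 0 : ℂ) * (t ^ n / (n.factorial : ℂ)))
      ((q + 1) / (2 * (Real.pi : ℂ)) *
        ∫ s in (-(2 * √(q : ℝ)))..(2 * √(q : ℝ)), contractibleIntegrand q t s) := by
  have hle : -(2 * √(q : ℝ)) ≤ 2 * √(q : ℝ) := by
    have := Real.sqrt_nonneg (q : ℝ); linarith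
  have key : HasSum (fun n : ℕ => ∫ s in (-(2 * √(q : ℝ)))..(2 * √(q : ℝ)),
      (t ^ n / (n.factorial : ℂ)) * ((s ^ n * treeDensity q s : ℝ) : ℂ))
      (∫ s in (-(2 * √(q : ℝ)))..(2 * √(q : ℝ)), contractibleIntegrand q t s) := by
    -- Since `|s| ≤ 2 √q`, the exponential series of `2 √q ‖t‖` times the density dominates.
    apply intervalIntegral.hasSum_integral_of_dominated_convergence
      (fun n s => (2 * √(q : ℝ) * ‖t‖) ^ n / (n.factorial : ℝ) * treeDensity q s)
    · intro n
      exact (intervalIntegrable_iff.1 ((intervalIntegrable_ofReal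
        (intervalIntegrable_pow_mul_treeDensity hq n)).const_mul _)).aestronglyMeasurable
    · intro n
      refine Filter.Eventually.of_forall fun s hs => ?_
      have hs' := Set.uIoc_subset_uIcc hs
      rw [uIcc_two_mul_sqrt] at hs'
      rw [norm_mul, norm_div, norm_pow, Complex.norm_natCast, Complex.norm_real, norm_mul,
        norm_pow, Real.norm_eq_abs, Real.norm_eq_abs, abs_of_nonneg (treeDensity_nonneg hs'),
        mul_pow, ← mul_assoc]
      apply mul_le_mul_of_nonneg_right _ (treeDensity_nonneg hs')
      rw [div_mul_eq_mul_div, mul_comm]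
      gcongr
      exact abs_le.2 hs'
    · exact Filter.Eventually.of_forall fun s _ =>
        (Real.summable_pow_div_factorial _).mul_right _
    · simp only [tsum_mul_right]
      exact (intervalIntegrable_treeDensity hq).const_mul _
    · refine Filter.Eventually.of_forall fun s _ => ?_
      rw [contractibleIntegrand_eq]
      have h := (NormedSpace.expSeries_div_hasSum_exp ((s : ℂ) * t)).mul_right
        (treeDensity q s : ℂ)
      rw [← Complex.exp_eq_exp_ℂ] at h
      refine Eq.mp (congrArg (HasSum · _) (funext fun n => ?_)) h
      push_cast
      ring
  refine Eq.mp (congrArg (HasSum · _) (funext fun n => ?_))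
    (key.mul_left ((q + 1) / (2 * (Real.pi : ℂ))))
  rw [intervalIntegral.integral_const_mul, intervalIntegral.integral_ofReal,
    ← Complex.ofReal_natCast (treeWalkCount q n 0), ← treeMoment_eq hq, treeMoment]
  push_cast
  ring

end TraceFormula

/-! ### Generating functions and regrouping of the sums -/

namespace TraceFormula

open SimpleGraph

section Fibres

variable {β ι : Type*} {g : β → ι} {f : ι → ℂ}

theorem tsum_fibre_const {E : Type*} [NormedRing E] (hfin : ∀ i, (g ⁻¹' {i}).Finite) (f : ι → E)
    (i : ι) : ∑' b : g ⁻¹' {i}, f (g b) = ((g ⁻¹' {i}).ncard : E) * f i := by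
  have := (hfin i).fintype
  have h : ∀ b : g ⁻¹' {i}, f (g b) = f i := fun b => congrArg f b.2
  simp only [h]
  rw [tsum_fintype, Finset.sum_const, Finset.card_univ, nsmul_eq_mul, ← Nat.card_eq_fintype_card]
  rfl

theorem hasSum_fibres (hfin : ∀ i, (g ⁻¹' {i}).Finite) (hs : Summable fun b => f (g b)) :
    HasSum (fun i => ((g ⁻¹' {i}).ncard : ℂ) * f i) (∑' b, f (g b)) := by
  have := hs.hasSum.tsum_fiberwise g
  simpa only [tsum_fibre_const hfin] using this

/-- In `ℂ` summability is absolute, and the norms over a fibre add up to its cardinality times the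
common norm. -/
theorem summable_of_fibres (hfin : ∀ i, (g ⁻¹' {i}).Finite)
    (hs : Summable fun i => ((g ⁻¹' {i}).ncard : ℂ) * f i) : Summable fun b => f (g b) := by
  apply Summable.of_norm
  rw [summable_partition (fun b => norm_nonneg _) (s := fun i => g ⁻¹' {i})
    (fun b => ⟨g b, rfl, fun i hi => hi.symm⟩)]
  refine ⟨fun i => ?_, ?_⟩
  · have := (hfin i).fintype
    exact (hasSum_fintype _).summable
  · have := hs.norm
    simp only [norm_mul, Complex.norm_natCast] at this
    simpa only [tsum_fibre_const hfin (fun i => ‖f i‖)] using this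

theorem hasSum_of_fibres (hfin : ∀ i, (g ⁻¹' {i}).Finite) {a : ℂ}
    (hs : HasSum (fun i => ((g ⁻¹' {i}).ncard : ℂ) * f i) a) : HasSum (fun b => f (g b)) a := by
  have h := summable_of_fibres hfin hs.summable
  rw [hs.unique (hasSum_fibres hfin h)]
  exact h.hasSum

end Fibres

section Matrix

theorem hasSum_trace_exp {n : Type*} [Fintype n] [DecidableEq n] (A : Matrix n n ℂ) (t : ℂ) :
    HasSum (fun k : ℕ => t ^ k / (k.factorial : ℂ) * (A ^ k).trace)
      (NormedSpace.exp (t • A)).trace := by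
  -- A submultiplicative norm is needed for the convergence of the exponential series.
  let _ := Matrix.linftyOpNormedRing (n := n) (α := ℂ)
  let _ := Matrix.linftyOpNormedAlgebra (n := n) (R := ℂ) (α := ℂ)
  have h := NormedSpace.exp_series_hasSum_exp' (𝕂 := ℂ) (t • A)
  have h' := h.map (Matrix.traceAddMonoidHom n ℂ) (Continuous.matrix_trace continuous_id)
  refine Eq.mp (congrArg (HasSum · _) (funext fun k => ?_)) h'
  simp only [Function.comp_apply, Matrix.traceAddMonoidHom_apply, smul_pow, Matrix.trace_smul,
    smul_eq_mul]
  ring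

end Matrix

theorem chebCoeff_mul_eq (q m l : ℕ) (t : ℂ) :
    t ^ (2 * m + l) / ((2 * m + l).factorial : ℂ) * chebCoeff q (2 * m + l) l =
      q ^ m * t ^ (2 * m + l) / ((m.factorial : ℂ) * ((m + l).factorial : ℂ)) := by
  have h := Nat.choose_mul_factorial_mul_factorial (show m ≤ 2 * m + l by omega)
  rw [show 2 * m + l - m = m + l by omega] at h
  have h' : ((2 * m + l).choose m : ℂ) * m.factorial * (m + l).factorial =
    (2 * m + l).factorial := by exact_mod_cast h
  have h1 : (m.factorial : ℂ) ≠ 0 := by exact_mod_cast m.factorial_ne_zero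
  have h2 : ((m + l).factorial : ℂ) ≠ 0 := by exact_mod_cast (m + l).factorial_ne_zero
  have h3 : ((2 * m + l).factorial : ℂ) ≠ 0 := by exact_mod_cast (2 * m + l).factorial_ne_zero
  rw [chebCoeff_two_mul_add]
  push_cast
  field_simp
  rw [← h']
  ring

theorem rpow_mul_sqrt_pow {q : ℕ} (hq : 1 ≤ q) (m l : ℕ) :
    (q : ℝ) ^ (-(l : ℝ) / 2) * √(q : ℝ) ^ (2 * m + l) = q ^ m := by
  have hq' : (0 : ℝ) < q := by exact_mod_cast hq
  rw [Real.sqrt_eq_rpow, ← Real.rpow_natCast, ← Real.rpow_mul hq'.le, ← Real.rpow_add hq',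
    ← Real.rpow_natCast]
  congr 1
  push_cast
  ring

theorem geodesicWeight_eq_tsum {q : ℕ} (hq : 1 ≤ q) (t : ℂ) (l : ℕ) :
    geodesicWeight q t l = ∑' n : ℕ, t ^ n / (n.factorial : ℂ) * chebCoeff q n l := by
  have hinj : Function.Injective fun m : ℕ => 2 * m + l := fun a b h => by
    simpa using h
  -- Only `n = 2m + l` contributes: other `n` are below `l` or of the wrong parity.
  rw [← hinj.tsum_eq]
  · rw [geodesicWeight, besselI, ← tsum_mul_left]
    refine tsum_congr fun m => ?_
    rw [chebCoeff_mul_eq, ← Complex.ofReal_natCast q, ← Complex.ofReal_pow,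
      ← rpow_mul_sqrt_pow hq m l]
    push_cast
    ring
  · intro n hn
    rw [Function.mem_support] at hn
    have h1 : l ≤ n := by
      by_contra h
      exact hn (by rw [chebCoeff_eq_zero_of_lt (by omega)]; simp)
    have h2 : Even (n + l) := by
      by_contra h
      exact hn (by rw [chebCoeff_eq_zero_of_odd (Nat.not_even_iff_odd.1 h)]; simp)
    obtain ⟨j, hj⟩ := h2
    exact ⟨j - l, by simp only; omega⟩

section Trajectories

variable {V : Type*} {G : SimpleGraph V}

/-- The geodesic paths of positive length. -/
def longGeodesicPaths {V : Type*} (G : SimpleGraph V) : Set (ClosedPath G) :=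
  {p | p.trajectory.IsGeodesic ∧ 0 < p.length}

/-- The trajectory of a geodesic path. -/
def longGeodesicPaths.trajectory (p : longGeodesicPaths G) : longGeodesics G :=
  ⟨p.1.trajectory, p.2⟩

theorem image_trajectory_fibre (γ : longGeodesics G) {p : ClosedPath G}
    (hp : p.trajectory = γ.1) : Subtype.val '' (longGeodesicPaths.trajectory ⁻¹' {γ}) =
      {p' : ClosedPath G | p'.trajectory = p.trajectory} := by
  ext p'
  constructor
  · rintro ⟨p', h, rfl⟩
    exact (congrArg Subtype.val h).trans hp.symm
  · intro h
    have h' : p'.trajectory = γ.1 := Eq.trans h hp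
    have hmem : p' ∈ longGeodesicPaths G := by
      have := γ.2
      rw [← h'] at this
      exact this
    exact ⟨⟨p', hmem⟩, Subtype.ext h', rfl⟩

theorem ncard_trajectory_fibre (γ : longGeodesics G) :
    (longGeodesicPaths.trajectory ⁻¹' {γ}).Finite ∧
      (longGeodesicPaths.trajectory ⁻¹' {γ}).ncard = γ.1.primitiveLength := by
  obtain ⟨p, hp⟩ := Quot.exists_rep γ.1
  change p.trajectory = γ.1 at hp
  have hpos : 0 < p.length := by
    have := γ.2.2
    rw [← hp] at this
    exact this
  constructor
  · apply Set.Finite.of_finite_image _ Subtype.val_injective.injOn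
    rw [image_trajectory_fibre γ hp]
    exact ClosedPath.finite_fiber hpos
  · rw [← Set.ncard_image_of_injective _ Subtype.val_injective, image_trajectory_fibre γ hp,
      ClosedPath.ncard_fiber hpos, hp]

theorem ncard_length_fibre (S : Set (ClosedPath G)) (n : ℕ) :
    ((fun p : S => p.1.length) ⁻¹' {n}).ncard = {p | p ∈ S ∧ p.length = n}.ncard := by
  rw [← Set.ncard_image_of_injective _ Subtype.val_injective]
  congr 1
  ext p
  constructor
  · rintro ⟨p, h, rfl⟩
    exact ⟨p.2, h⟩
  · rintro ⟨h, h'⟩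
    exact ⟨⟨p, h⟩, h', rfl⟩

end Trajectories

section Graph

variable {V : Type*} [Fintype V] [DecidableEq V] {G : SimpleGraph V} [DecidableRel G.Adj]

theorem finite_setOf_length_eq (n : ℕ) : {p : ClosedPath G | p.length = n}.Finite := by
  refine ((Finset.univ.sigma fun v => G.finsetWalkLength n v v :
    Finset (ClosedPath G)).finite_toSet).subset fun p hp => ?_
  simpa [mem_finsetWalkLength_iff, ClosedPath.length] using hp

theorem finite_length_fibre (S : Set (ClosedPath G)) (n : ℕ) :
    ((fun p : S => p.1.length) ⁻¹' {n}).Finite :=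
  Set.Finite.preimage (f := Subtype.val) Subtype.val_injective.injOn (finite_setOf_length_eq n)

variable {q : ℕ}

theorem hasSum_contractiblePaths (hq : 1 ≤ q) (hreg : G.IsRegularOfDegree (q + 1)) (t : ℂ) :
    HasSum (fun p : contractiblePaths G => t ^ p.1.length / (p.1.length.factorial : ℂ))
      ((Fintype.card V : ℂ) * ((q + 1) / (2 * (Real.pi : ℂ))) *
        ∫ s in (-(2 * √(q : ℝ)))..(2 * √(q : ℝ)), contractibleIntegrand q t s) := by
  apply hasSum_of_fibres (g := fun p : contractiblePaths G => p.1.length)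
    (f := fun n => t ^ n / (n.factorial : ℂ)) (finite_length_fibre _)
  have h := (hasSum_treeWalkCount hq t).mul_left (Fintype.card V : ℂ)
  rw [← mul_assoc] at h
  refine Eq.mp (congrArg (HasSum · _) (funext fun n => ?_)) h
  rw [ncard_length_fibre, ncard_contractiblePaths hreg]
  push_cast
  ring

theorem trace_adjMatrix_pow_eq_geodesicPathCount (hreg : G.IsRegularOfDegree (q + 1)) (n : ℕ) :
    (G.adjMatrix ℂ ^ n).trace = Fintype.card V * treeWalkCount q n 0 +
      ∑ k ∈ Finset.range n, (chebCoeff q n (k + 1) : ℂ) * geodesicPathCount G (k + 1) := by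
  rw [trace_adjMatrix_pow hreg]
  simp only [geodesicPathCount_succ]

theorem hasSum_sum_geodesicPathCount (hq : 1 ≤ q) (hreg : G.IsRegularOfDegree (q + 1)) (t : ℂ) :
    HasSum (fun n : ℕ => t ^ n / (n.factorial : ℂ) *
      ∑ k ∈ Finset.range n, (chebCoeff q n (k + 1) : ℂ) * geodesicPathCount G (k + 1))
      (stateSum G t - (Fintype.card V : ℂ) * ((q + 1) / (2 * (Real.pi : ℂ))) *
        ∫ s in (-(2 * √(q : ℝ)))..(2 * √(q : ℝ)), contractibleIntegrand q t s) := by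
  have h := (hasSum_treeWalkCount hq t).mul_left (Fintype.card V : ℂ)
  rw [← mul_assoc] at h
  have h' := (hasSum_trace_exp (G.adjMatrix ℂ) t).sub h
  refine Eq.mp (congrArg (HasSum · _) (funext fun n => ?_)) h'
  rw [trace_adjMatrix_pow_eq_geodesicPathCount hreg]
  ring

theorem hasSum_chebCoeff_mul {E : Type*} [NormedRing E] (x : E) (c : ℕ → E) (n : ℕ) :
    HasSum (fun k : ℕ => x * ((chebCoeff q n (k + 1) : E) * c k))
      (x * ∑ k ∈ Finset.range n, (chebCoeff q n (k + 1) : E) * c k) := by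
  rw [Finset.mul_sum]
  apply hasSum_sum_of_ne_finset_zero
  intro k hk
  rw [Finset.mem_range] at hk
  rw [chebCoeff_eq_zero_of_lt (by omega)]
  simp

/-- Joint summability permits the exchange of the sums over powers and lengths. Taking norms
replaces `t` by `‖t‖`, where the row sums converge by `hasSum_sum_geodesicPathCount`. -/
theorem hasSum_prod_geodesicPathCount (hq : 1 ≤ q) (hreg : G.IsRegularOfDegree (q + 1)) (t : ℂ) :
    HasSum (fun x : ℕ × ℕ => t ^ x.1 / (x.1.factorial : ℂ) *
      ((chebCoeff q x.1 (x.2 + 1) : ℂ) * geodesicPathCount G (x.2 + 1)))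
      (stateSum G t - (Fintype.card V : ℂ) * ((q + 1) / (2 * (Real.pi : ℂ))) *
        ∫ s in (-(2 * √(q : ℝ)))..(2 * √(q : ℝ)), contractibleIntegrand q t s) := by
  have hs : Summable (fun x : ℕ × ℕ => t ^ x.1 / (x.1.factorial : ℂ) *
      ((chebCoeff q x.1 (x.2 + 1) : ℂ) * geodesicPathCount G (x.2 + 1))) := by
    apply Summable.of_norm
    simp only [norm_mul, norm_div, norm_pow, Complex.norm_natCast]
    rw [summable_prod_of_nonneg (fun x => by positivity)]
    have hrow (n : ℕ) := hasSum_chebCoeff_mul (q := q) (‖t‖ ^ n / (n.factorial : ℝ))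
      (fun k => (geodesicPathCount G (k + 1) : ℝ)) n
    refine ⟨fun n => (hrow n).summable, ?_⟩
    rw [funext fun n => (hrow n).tsum_eq, ← Complex.summable_ofReal]
    have := (hasSum_sum_geodesicPathCount hq hreg (‖t‖ : ℂ)).summable
    push_cast
    exact this
  have h := hs.hasSum.prod_fiberwise fun n => hasSum_chebCoeff_mul (q := q)
    (t ^ n / (n.factorial : ℂ)) (fun k => (geodesicPathCount G (k + 1) : ℂ)) n
  rw [(hasSum_sum_geodesicPathCount hq hreg t).unique h]
  exact hs.hasSum

theorem hasSum_geodesicPathCount_succ (hq : 1 ≤ q) (hreg : G.IsRegularOfDegree (q + 1)) (t : ℂ) :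
    HasSum (fun l : ℕ => (geodesicPathCount G (l + 1) : ℂ) * geodesicWeight q t (l + 1))
      (stateSum G t - (Fintype.card V : ℂ) * ((q + 1) / (2 * (Real.pi : ℂ))) *
        ∫ s in (-(2 * √(q : ℝ)))..(2 * √(q : ℝ)), contractibleIntegrand q t s) := by
  have h := (Equiv.prodComm ℕ ℕ).hasSum_iff.2 (hasSum_prod_geodesicPathCount hq hreg t)
  have h' := h.prod_fiberwise fun l => (h.summable.prod_factor l).hasSum
  refine Eq.mp (congrArg (HasSum · _) (funext fun l => ?_)) h'
  rw [geodesicWeight_eq_tsum hq, ← tsum_mul_left]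
  refine tsum_congr fun n => ?_
  simp only [Function.comp_apply, Equiv.prodComm_apply, Prod.swap_prod_mk]
  ring

theorem hasSum_geodesicPathCount (hq : 1 ≤ q) (hreg : G.IsRegularOfDegree (q + 1)) (t : ℂ) :
    HasSum (fun l : ℕ => (geodesicPathCount G (l + 3) : ℂ) * geodesicWeight q t (l + 3))
      (stateSum G t - (Fintype.card V : ℂ) * ((q + 1) / (2 * (Real.pi : ℂ))) *
        ∫ s in (-(2 * √(q : ℝ)))..(2 * √(q : ℝ)), contractibleIntegrand q t s) := by
  have h := (hasSum_nat_add_iff' 2).2 (hasSum_geodesicPathCount_succ hq hreg t)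
  simpa [Finset.sum_range_succ, geodesicPathCount_one, geodesicPathCount_two] using h

theorem hasSum_longGeodesics (hq : 1 ≤ q) (hreg : G.IsRegularOfDegree (q + 1)) (t : ℂ) :
    HasSum (fun γ : longGeodesics G => (γ.1.primitiveLength : ℂ) * geodesicWeight q t γ.1.length)
      (stateSum G t - (Fintype.card V : ℂ) * ((q + 1) / (2 * (Real.pi : ℂ))) *
        ∫ s in (-(2 * √(q : ℝ)))..(2 * √(q : ℝ)), contractibleIntegrand q t s) := by
  -- The length is shifted to match a series starting at `l + 1`; positivity keeps the subtraction
  -- from truncating.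
  have hfib : ∀ n, (fun p : longGeodesicPaths G => p.1.length - 1) ⁻¹' {n} =
      (fun p : longGeodesicPaths G => p.1.length) ⁻¹' {n + 1} := by
    intro n
    ext p
    have := p.2.2
    simp only [Set.mem_preimage, Set.mem_singleton_iff]
    omega
  have h1 : HasSum (fun p : longGeodesicPaths G => geodesicWeight q t (p.1.length - 1 + 1))
      (stateSum G t - (Fintype.card V : ℂ) * ((q + 1) / (2 * (Real.pi : ℂ))) *
        ∫ s in (-(2 * √(q : ℝ)))..(2 * √(q : ℝ)), contractibleIntegrand q t s) := by
    apply hasSum_of_fibres (g := fun p : longGeodesicPaths G => p.1.length - 1)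
      (f := fun n => geodesicWeight q t (n + 1))
    · intro n
      rw [hfib]
      exact finite_length_fibre _ _
    · refine Eq.mp (congrArg (HasSum · _) (funext fun n => ?_))
        (hasSum_geodesicPathCount_succ hq hreg t)
      rw [hfib, ncard_length_fibre, geodesicPathCount]
      congr 3
      ext p
      simp only [longGeodesicPaths, Set.mem_ofPred_eq]
      constructor
      · rintro ⟨h, h'⟩
        exact ⟨⟨h, by omega⟩, h'⟩
      · rintro ⟨⟨h, -⟩, h'⟩
        exact ⟨h, h'⟩
  have h2 : (fun p : longGeodesicPaths G => geodesicWeight q t (p.1.length - 1 + 1)) =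
      fun p => geodesicWeight q t (longGeodesicPaths.trajectory p).1.length := by
    funext p
    rw [Nat.sub_add_cancel p.2.2]
    rfl
  rw [h2] at h1
  -- The sum over geodesic paths is regrouped by trajectory, each fibre having `Λ(γ)` elements.
  have h3 := hasSum_fibres (g := longGeodesicPaths.trajectory (G := G))
    (f := fun γ => geodesicWeight q t γ.1.length) (fun γ => (ncard_trajectory_fibre γ).1)
    h1.summable
  rw [h1.tsum_eq] at h3
  simpa only [(ncard_trajectory_fibre _).2] using h3

end Graph

end TraceFormula

open TraceFormula in
theorem mainTheorem1 {V : Type*} [Fintype V] [DecidableEq V] (G : SimpleGraph V)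
    [DecidableRel G.Adj] (q : ℕ) (hq : 1 ≤ q) (hconn : G.Connected)
    (hreg : G.IsRegularOfDegree (q + 1)) (t : ℂ) :
    -- the integral converges
    IntervalIntegrable (contractibleIntegrand q t) MeasureTheory.volume
      (-(2 * √(q : ℝ))) (2 * √(q : ℝ)) ∧
    -- it gives the contribution of the contractible closed paths
    HasSum (fun p : contractiblePaths G => t ^ p.1.length / (p.1.length.factorial : ℂ))
      ((Fintype.card V : ℂ) * ((q + 1) / (2 * (Real.pi : ℂ))) *
        ∫ s in (-(2 * √(q : ℝ)))..(2 * √(q : ℝ)), contractibleIntegrand q t s) ∧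
    -- the sum over long geodesics
    Summable (fun γ : longGeodesics G =>
      (γ.1.primitiveLength : ℂ) * geodesicWeight q t γ.1.length) ∧
    stateSum G t =
      (Fintype.card V : ℂ) * ((q + 1) / (2 * (Real.pi : ℂ))) *
        (∫ s in (-(2 * √(q : ℝ)))..(2 * √(q : ℝ)), contractibleIntegrand q t s) +
      ∑' γ : longGeodesics G, (γ.1.primitiveLength : ℂ) * geodesicWeight q t γ.1.length ∧
    -- the sum over lengths `l ≥ 3`
    Summable (fun l : ℕ => (geodesicPathCount G (l + 3) : ℂ) * geodesicWeight q t (l + 3)) ∧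
    stateSum G t =
      (Fintype.card V : ℂ) * ((q + 1) / (2 * (Real.pi : ℂ))) *
        (∫ s in (-(2 * √(q : ℝ)))..(2 * √(q : ℝ)), contractibleIntegrand q t s) +
      ∑' l : ℕ, (geodesicPathCount G (l + 3) : ℂ) * geodesicWeight q t (l + 3) := by
  have hcon := hasSum_contractiblePaths hq hreg t
  have hgeo := hasSum_longGeodesics hq hreg t
  have hlen := hasSum_geodesicPathCount hq hreg t
  refine ⟨intervalIntegrable_contractibleIntegrand hq t, hcon, hgeo.summable, ?_,
    hlen.summable, ?_⟩
  · rw [hgeo.tsum_eq]; ring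
  · rw [hlen.tsum_eq]; ring
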